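/- Let $\mathcal U\subseteq\{-1,0,1\}\setminus\{0\}$, $\mathcal V\subseteq\{-1,0,1\}$ and $\mathcal T\subseteq\{-1,0,1\}^2\setminus\{(0,0)\}$, and let $\mathcal S\subseteq\{-1,0,1\}^3\setminus\{(0,0,0)\}$ be the $(1,2)$-Hadamard step set $$\mathcal S=\left(\mathcal U\times\{0\}^2\right)\cup\left(\mathcal V\times\mathcal T\right).$$ All walks start at the origin, and $\mathbb N=\{0,1,2,\dots\}$. A coloured $(\mathcal U,\mathcal V)$-walk is a walk on $\mathbb N$ with steps in $\mathcal U\cup\mathcal V$, each step being coloured black or white, such that all steps of $\mathcal U\setminus\mathcal V$ are white and all steps of $\mathcal V\setminus\mathcal U$ are black. Define * $C_1(x,v;t)=\sum_{i,k,n\ge 0} c_1(i,k;n)\,x^iv^kt^n$, where $c_1(i,k;n)$ is the number of coloured $(\mathcal U,\mathcal V)$-walks with $n$ steps, exactly $k$ of them black, that end at $i$; * $C_2(y,z;t)=\sum_{j,k,n\ge 0} c_2(j,k;n)\,y^jz^kt^n$, where $c_2(j,k;n)$ is the number of $n$-step walks with steps in $\mathcal T$ that stay in the quadrant $\mathbb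 N^2$ and end at $(j,k)$; * $O(x,y,z;t)=\sum_{i,j,k,n\ge 0} o(i,j,k;n)\,x^iy^jz^kt^n$, where $o(i,j,k;n)$ is the number of $n$-step walks with steps in $\mathcal S$ that stay in the octant $\mathbb N^3$ and end at $(i,j,k)$. A formal power series $F(x_1,\dots,x_r)$ with rational coefficients is algebraic if $P(x_1,\dots,x_r,F)=0$ for some non-zero polynomial $P\in\mathbb Q[x_1,\dots,x_r,s]$. It is D-finite (in all its variables) if for each $i$ the vector space over $\mathbb Q(x_1,\dots,x_r)$ spanned by the iterated derivatives $\partial^m F/\partial x_i^m$, $m\ge 0$, has finite dimension. Then: 1. the series $C_1(x,v;t)$ is algebraic; 2. if the series $C_2(y,z;t)$ is D-finite, then the series $O(x,y,z;t)$ is D-finite. -/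

import Mathlib

namespace OctantWalks

/-- The set `{-1, 0, 1}^D` of small steps. -/
def smallSteps (D : ℕ) : Set (Fin D → ℤ) :=
  {s | ∀ i, s i ∈ ({-1, 0, 1} : Set ℤ)}

/-- Walks (given as their lists of steps) that start at the origin, take all their steps in `S`
and stay in the orthant `ℕ^D`: the point reached after every initial segment is nonnegative. -/
def orthantWalks {D : ℕ} (S : Set (Fin D → ℤ)) : Set (List (Fin D → ℤ)) :=
  {w | (∀ s ∈ w, s ∈ S) ∧ ∀ p, p <+: w → 0 ≤ p.sum}

/-- The number of `n`-step walks with steps in `S`, confined to `ℕ^D`, that end at `e`. -/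
noncomputable def walkCount {D : ℕ} (S : Set (Fin D → ℤ)) (e : Fin D → ℕ) (n : ℕ) : ℕ :=
  {w | w ∈ orthantWalks S ∧ w.length = n ∧ w.sum = fun i => (e i : ℤ)}.ncard

/-- The generating function `∑ o(e; n) x₁^{e₁} ⋯ x_D^{e_D} t^n` of walks confined to `ℕ^D`.
The variable `Sum.inl i` is `x_i`, and `Sum.inr ()` is the length variable `t`. -/
noncomputable def walkGF {D : ℕ} (S : Set (Fin D → ℤ)) : MvPowerSeries (Fin D ⊕ Unit) ℚ :=
  fun m => (walkCount S (fun i => m (Sum.inl i)) (m (Sum.inr ())) : ℚ)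

/-- Coloured `(U, V)`-walks. A coloured step is a pair of a step of `U ∪ V` and a colour,
`true` for black and `false` for white; steps of `U \ V` are white, and steps of `V \ U` are
black. The walk, without its colours, is confined to `ℕ^d`. -/
def colouredWalks {d : ℕ} (U V : Set (Fin d → ℤ)) : Set (List ((Fin d → ℤ) × Bool)) :=
  {w | w.map Prod.fst ∈ orthantWalks (U ∪ V) ∧
    ∀ s ∈ w, (s.1 ∈ U \ V → s.2 = false) ∧ (s.1 ∈ V \ U → s.2 = true)}

/-- The number of coloured `(U, V)`-walks with `n` steps, `k` of them black, that end at `e`. -/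
noncomputable def colouredCount {d : ℕ} (U V : Set (Fin d → ℤ)) (e : Fin d → ℕ) (k n : ℕ) : ℕ :=
  {w | w ∈ colouredWalks U V ∧ w.length = n ∧ (w.map Prod.snd).count true = k ∧
    (w.map Prod.fst).sum = fun i => (e i : ℤ)}.ncard

/-- The generating function `C₁(x₁, …, x_d, v; t)` of coloured `(U, V)`-walks. The variable
`Sum.inl i` is `x_i`, `Sum.inr 0` is `v` (number of black steps), `Sum.inr 1` is `t` (length). -/
noncomputable def colouredGF {d : ℕ} (U V : Set (Fin d → ℤ)) :
    MvPowerSeries (Fin d ⊕ Fin 2) ℚ :=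
  fun m => (colouredCount U V (fun i => m (Sum.inl i)) (m (Sum.inr 0)) (m (Sum.inr 1)) : ℚ)

/-- The step set `(U × {0}^δ) ∪ (V × T)`. -/
def hadamardSteps {d δ : ℕ} (U V : Set (Fin d → ℤ)) (T : Set (Fin δ → ℤ)) :
    Set (Fin (d + δ) → ℤ) :=
  Set.image2 Fin.append U {0} ∪ Set.image2 Fin.append V T

/-- The field of rational functions `ℚ(x_i : i ∈ σ)`, inside the fraction field of the ring of
formal power series in the same variables. -/
noncomputable abbrev ratFunField (σ : Type) :
    IntermediateField ℚ (FractionRing (MvPowerSeries σ ℚ)) :=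
  IntermediateField.adjoin ℚ (Set.range fun i : σ =>
    algebraMap (MvPowerSeries σ ℚ) (FractionRing (MvPowerSeries σ ℚ)) (MvPowerSeries.X i))

/-- `F` is D-finite with respect to the variable `i`: the iterated partial derivatives
`D_i^m F`, `m ≥ 0`, span a finite-dimensional vector space over the field of rational functions
in all the variables. -/
def DFiniteWrt {σ : Type} (i : σ) (F : MvPowerSeries σ ℚ) : Prop :=
  FiniteDimensional (ratFunField σ)
    (Submodule.span (ratFunField σ) (Set.range fun m : ℕ =>
      algebraMap (MvPowerSeries σ ℚ) (FractionRing (MvPowerSeries σ ℚ))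
        ((MvPowerSeries.pderiv ℚ i)^[m] F)))

/-- `F` is D-finite (in all its variables): it is D-finite with respect to each of them. -/
def DFinite {σ : Type} (F : MvPowerSeries σ ℚ) : Prop :=
  ∀ i, DFiniteWrt i F

end OctantWalks

/-!
A coloured walk on the half-line obeys a linear functional equation whose kernel
`x - t (a + b x + c x²)` has coefficients in `ℚ[v]`. It factors through its small root, which is a
Catalan series; since a series without `x` that is a multiple of the kernel vanishes, `C₁` is the
inverse of the other factor of the kernel, and this is algebraic.

A Hadamard walk is a coloured walk whose steps taken from `V` carry a walk with steps in `T`, so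
that `O` arises from the product of `C₂` and the series `C₁` (with the colours exchanged) by taking
a diagonal. A D-finite series lies in a finitely generated module of series over the polynomials
that is closed under the derivations up to denominators; algebraic series do as well, and this
property is stable under products. A diagonal of such a series is D-finite by Lipshitz's argument:
the derivatives of bounded order, multiplied by monomials of bounded degree, are more numerous than
the dimension of the space containing them, and the resulting linear relation, chosen among
operators that are triangular with respect to the superdiagonals, induces a differential equation
for the diagonal.
-/

namespace OctantWalks

open MvPowerSeries

section Saturation

variable {R M : Type*} [CommRing R] [IsDomain R] [AddCommGroup M] [Module R M]
  {N N' : Submodule R M}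

/-- The saturation of a submodule `N`: the elements that lie in `N` up to a denominator, that is,
after multiplication by some nonzero scalar. -/
def saturation (N : Submodule R M) : Submodule R M :=
  (Submodule.torsion R (M ⧸ N)).comap N.mkQ

theorem mem_saturation {h : M} : h ∈ saturation N ↔ ∃ q : R, q ≠ 0 ∧ q • h ∈ N := by
  simp only [saturation, Submodule.mem_comap, Submodule.mem_torsion_iff, Subtype.exists,
    mem_nonZeroDivisors_iff_ne_zero, Submonoid.mk_smul, Submodule.mkQ_apply,
    ← Submodule.Quotient.mk_smul, Submodule.Quotient.mk_eq_zero, exists_prop]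

theorem le_saturation : N ≤ saturation N :=
  fun _ hh => mem_saturation.2 ⟨1, one_ne_zero, by rwa [one_smul]⟩

theorem mem_saturation_of_smul_mem {q : R} (hq : q ≠ 0) {h : M} (hh : q • h ∈ saturation N) :
    h ∈ saturation N := by
  obtain ⟨p, hp, hph⟩ := mem_saturation.1 hh
  exact mem_saturation.2 ⟨p * q, mul_ne_zero hp hq, by rwa [mul_smul]⟩

theorem saturation_le (h : N ≤ saturation N') : saturation N ≤ saturation N' := fun _ hm =>
  have ⟨_, hq, hqm⟩ := mem_saturation.1 hm
  mem_saturation_of_smul_mem hq (h hqm)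

theorem saturation_mono (h : N ≤ N') : saturation N ≤ saturation N' :=
  saturation_le (h.trans le_saturation)

end Saturation

section Holonomic

variable {σ R : Type*} [CommRing R]

theorem algebraMap_mvPolynomial_eq_coe (p : MvPolynomial σ R) :
    algebraMap (MvPolynomial σ R) (MvPowerSeries σ R) p = (p : MvPowerSeries σ R) := by
  ext n
  simp only [algebraMap_apply', Algebra.algebraMap_self, map_id, RingHom.id_apply]

theorem mvPolynomial_smul_eq_coe_mul (p : MvPolynomial σ R) (h : MvPowerSeries σ R) :
    p • h = (p : MvPowerSeries σ R) * h := by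
  rw [Algebra.smul_def, algebraMap_mvPolynomial_eq_coe]

instance : FaithfulSMul (MvPolynomial σ R) (MvPowerSeries σ R) :=
  (faithfulSMul_iff_algebraMap_injective _ _).2 fun p q h => by
    simpa only [algebraMap_mvPolynomial_eq_coe, MvPolynomial.coe_inj] using h

theorem pderiv_mvPolynomial_smul (i : σ) (p : MvPolynomial σ R) (h : MvPowerSeries σ R) :
    pderiv R i (p • h) = p • pderiv R i h + MvPolynomial.pderiv i p • h := by
  simp only [mvPolynomial_smul_eq_coe_mul, Derivation.leibniz, smul_eq_mul, pderiv_coe]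
  ring

theorem pderiv_comm (i j : σ) (h : MvPowerSeries σ R) :
    pderiv R i (pderiv R j h) = pderiv R j (pderiv R i h) := by
  classical
  ext n
  obtain rfl | hij := eq_or_ne i j
  · rfl
  · simp only [coeff_pderiv, Finsupp.add_apply, add_right_comm n,
      Finsupp.single_eq_of_ne hij, Finsupp.single_eq_of_ne hij.symm]
    push_cast
    ring

variable {N N' : Submodule (MvPolynomial σ R) (MvPowerSeries σ R)}

theorem pderiv_mem_of_mem_span {i : σ} {s : Set (MvPowerSeries σ R)} (hs : s ⊆ N)
    (hN : ∀ h ∈ s, pderiv R i h ∈ N) {h : MvPowerSeries σ R}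
    (hh : h ∈ Submodule.span (MvPolynomial σ R) s) : pderiv R i h ∈ N := by
  induction hh using Submodule.span_induction with
  | mem x hx => exact hN x hx
  | zero => simp only [map_zero, zero_mem]
  | add x y _ _ hx hy => rw [map_add]; exact N.add_mem hx hy
  | smul a x hx ih =>
    rw [pderiv_mvPolynomial_smul]
    exact N.add_mem (N.smul_mem _ ih) (N.smul_mem _ (Submodule.span_le.2 hs hx))

variable [IsDomain R]

theorem pderiv_mem_saturation {i : σ} (hle : N ≤ saturation N')
    (hN : ∀ h ∈ N, pderiv R i h ∈ saturation N') {h : MvPowerSeries σ R}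
    (hh : h ∈ saturation N) : pderiv R i h ∈ saturation N' := by
  obtain ⟨q, hq, hqh⟩ := mem_saturation.1 hh
  have hsum := hN _ hqh
  rw [pderiv_mvPolynomial_smul] at hsum
  exact mem_saturation_of_smul_mem hq <| (Submodule.add_mem_iff_left _ <|
    (saturation N').smul_mem _ (saturation_le hle hh)).1 hsum

/-- A power series is holonomic if it belongs to a finitely generated module over the polynomials
that is closed, up to denominators, under all partial derivatives. For finitely many variables over
`ℚ` a D-finite series has this property (`DFinite.holonomic`), which involves no fraction field. -/
def Holonomic (F : MvPowerSeries σ R) : Prop :=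
  ∃ N : Submodule (MvPolynomial σ R) (MvPowerSeries σ R), N.FG ∧ F ∈ N ∧
    ∀ i, ∀ h ∈ N, pderiv R i h ∈ saturation N

theorem Holonomic.mul {F G : MvPowerSeries σ R} (hF : Holonomic F) (hG : Holonomic G) :
    Holonomic (F * G) := by
  obtain ⟨N, hN, hFN, hdN⟩ := hF
  obtain ⟨M, hM, hGM, hdM⟩ := hG
  refine ⟨N * M, hN.mul hM, Submodule.mul_mem_mul hFN hGM, fun i h hh => ?_⟩
  induction hh using Submodule.mul_induction_on' with
  | mem_mul_mem x hx y hy =>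
    obtain ⟨p, hp, hpx⟩ := mem_saturation.1 (hdN i x hx)
    obtain ⟨q, hq, hqy⟩ := mem_saturation.1 (hdM i y hy)
    rw [Derivation.leibniz, smul_eq_mul, smul_eq_mul]
    refine (saturation _).add_mem (mem_saturation.2 ⟨q, hq, ?_⟩) (mem_saturation.2 ⟨p, hp, ?_⟩)
    · rw [← mul_smul_comm]; exact Submodule.mul_mem_mul hx hqy
    · rw [mul_comm y, ← smul_mul_assoc]; exact Submodule.mul_mem_mul hpx hy
  | add x _ y _ hx hy => rw [map_add]; exact (saturation _).add_mem hx hy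

end Holonomic

section Rename

variable {σ τ : Type*} (e : σ ↪ τ)

theorem coeff_rename_eq_zero_of_ne_zero {R : Type*} [CommSemiring R]
    {F : MvPowerSeries σ R} {m : τ →₀ ℕ} {j : τ} (hj : j ∉ Set.range e) (hm : m j ≠ 0) :
    coeff m (rename e F) = 0 := by
  refine coeff_rename_eq_zero _ _ ?_
  rintro ⟨x, rfl⟩
  exact hm (Finsupp.mapDomain_of_notMem_range _ _ hj)

theorem exists_embDomain_eq {m : τ →₀ ℕ} (hm : ∀ j ∉ Set.range e, m j = 0) :
    ∃ x : σ →₀ ℕ, x.embDomain e = m := by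
  refine ⟨m.comapDomain e e.injective.injOn, ?_⟩
  rw [Finsupp.embDomain_eq_mapDomain]
  refine Finsupp.mapDomain_comapDomain _ e.injective _ fun j hj => ?_
  by_contra hne
  exact (Finsupp.mem_support_iff.1 hj) (hm j hne)

variable {R : Type*} [CommRing R]

theorem pderiv_rename_of_notMem_range {j : τ} (hj : j ∉ Set.range e) (F : MvPowerSeries σ R) :
    pderiv R j (rename e F) = 0 := by
  classical
  ext m
  rw [coeff_pderiv, coeff_rename_eq_zero_of_ne_zero e hj (by simp), zero_mul, map_zero]

theorem pderiv_rename (i : σ) (F : MvPowerSeries σ R) :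
    pderiv R (e i) (rename e F) = rename e (pderiv R i F) := by
  classical
  ext m
  rw [coeff_pderiv]
  by_cases hm : ∀ j ∉ Set.range e, m j = 0
  · obtain ⟨x, rfl⟩ := exists_embDomain_eq e hm
    rw [← Finsupp.embDomain_single, ← Finsupp.embDomain_add, coeff_embDomain_rename,
      coeff_embDomain_rename, coeff_pderiv, Finsupp.embDomain_apply_self]
  · push Not at hm
    obtain ⟨j, hj, hmj⟩ := hm
    rw [coeff_rename_eq_zero_of_ne_zero e hj hmj, coeff_rename_eq_zero_of_ne_zero e hj, zero_mul]
    rw [Finsupp.add_apply]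
    omega

theorem rename_mem_span {s : Set (MvPowerSeries σ R)} {h : MvPowerSeries σ R}
    (hh : h ∈ Submodule.span (MvPolynomial σ R) s) :
    rename e h ∈ Submodule.span (MvPolynomial τ R) (rename e '' s) := by
  induction hh using Submodule.span_induction with
  | mem x hx => exact Submodule.subset_span ⟨x, hx, rfl⟩
  | zero => simp only [map_zero, zero_mem]
  | add x y _ _ hx hy => rw [map_add]; exact Submodule.add_mem _ hx hy
  | smul a x hx ih =>
    rw [mvPolynomial_smul_eq_coe_mul, map_mul, rename_coe, ← mvPolynomial_smul_eq_coe_mul]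
    exact Submodule.smul_mem _ _ ih

variable [IsDomain R]

theorem rename_mem_saturation {s : Set (MvPowerSeries σ R)} {h : MvPowerSeries σ R}
    (hh : h ∈ saturation (Submodule.span (MvPolynomial σ R) s)) :
    rename e h ∈ saturation (Submodule.span (MvPolynomial τ R) (rename e '' s)) := by
  obtain ⟨q, hq, hqh⟩ := mem_saturation.1 hh
  refine mem_saturation.2 ⟨MvPolynomial.rename e q, ?_, ?_⟩
  · rwa [Ne, map_eq_zero_iff _ (MvPolynomial.rename_injective _ e.injective)]
  · rw [mvPolynomial_smul_eq_coe_mul, ← rename_coe (f := e), ← map_mul,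
      ← mvPolynomial_smul_eq_coe_mul]
    exact rename_mem_span e hqh

theorem Holonomic.rename {F : MvPowerSeries σ R} (hF : Holonomic F) :
    Holonomic (rename e F) := by
  obtain ⟨N, ⟨s, rfl⟩, hFN, hdN⟩ := hF
  refine ⟨_, Submodule.fg_span (s.finite_toSet.image (MvPowerSeries.rename e)),
    rename_mem_span e hFN, fun j h hh => ?_⟩
  refine pderiv_mem_of_mem_span (Submodule.subset_span.trans le_saturation) ?_ hh
  rintro _ ⟨x, hx, rfl⟩
  by_cases hj : j ∈ Set.range e
  · obtain ⟨i, rfl⟩ := hj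
    rw [pderiv_rename]
    exact rename_mem_saturation e (hdN i x (Submodule.subset_span hx))
  · rw [pderiv_rename_of_notMem_range e hj]
    exact Submodule.zero_mem _

end Rename

section Algebraic

open Polynomial

variable {A B : Type*} [CommRing A] [CommRing B] [Algebra A B]

theorem exists_aeval_mul_eq_algebraMap_of_isAlgebraic [NoZeroDivisors B] {β : B}
    (hβ : IsAlgebraic A β) (h0 : β ≠ 0) :
    ∃ (g : A[X]) (c : A), c ≠ 0 ∧ aeval β g * β = algebraMap A B c := by
  obtain ⟨p, hp0, hp⟩ :=
    hβ.exists_nonzero_coeff_and_aeval_eq_zero (mem_nonZeroDivisors_of_ne_zero h0)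
  refine ⟨-p.divX, p.coeff 0, hp0, ?_⟩
  rw [← p.divX_mul_X_add] at hp
  simp only [map_add, map_mul, aeval_X, aeval_C] at hp
  rw [map_neg]
  linear_combination -hp

variable [IsDomain A]

theorem exists_aeval_eq_zero_and_aeval_derivative_ne_zero [CharZero A] [FaithfulSMul A B] {α : B}
    (hα : IsAlgebraic A α) : ∃ p : A[X], aeval α p = 0 ∧ aeval α (derivative p) ≠ 0 := by
  obtain ⟨p, hp0, hp⟩ := hα
  induction hn : p.natDegree using Nat.strong_induction_on generalizing p with
  | _ n ih =>
    by_cases hder : aeval α (derivative p) = 0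
    · have hdeg : p.natDegree ≠ 0 := by
        rintro hdeg
        obtain ⟨c, rfl⟩ := natDegree_eq_zero.1 hdeg
        rw [aeval_C, FaithfulSMul.algebraMap_eq_zero_iff] at hp
        exact hp0 (by rw [hp, C_0])
      exact ih _ (hn ▸ natDegree_derivative_lt hdeg) _
        (fun h => hdeg (derivative_eq_zero.1 h)) hder rfl
    · exact ⟨p, hp, hder⟩

theorem pow_mem_saturation_span_pow {α : B} {p : A[X]} (hp0 : p ≠ 0) (hp : aeval α p = 0)
    (m : ℕ) :
    α ^ m ∈ saturation (Submodule.span A ((α ^ · : ℕ → B) '' Set.Iic p.natDegree)) := by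
  induction m using Nat.strong_induction_on with
  | _ m ih =>
    rcases le_or_gt m p.natDegree with hm | hm
    · exact le_saturation (Submodule.subset_span ⟨m, hm, rfl⟩)
    · refine mem_saturation_of_smul_mem (leadingCoeff_ne_zero.2 hp0) ?_
      have hrec : p.leadingCoeff • α ^ m =
          -∑ k ∈ Finset.range p.natDegree, p.coeff k • α ^ (k + (m - p.natDegree)) := by
        have hmul : aeval α p * α ^ (m - p.natDegree) = 0 := by rw [hp, zero_mul]
        rw [aeval_eq_sum_range, Finset.sum_range_succ, add_mul, Finset.sum_mul, smul_mul_assoc,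
          ← pow_add, Nat.add_sub_cancel' hm.le] at hmul
        simp only [smul_mul_assoc, ← pow_add] at hmul
        exact eq_neg_of_add_eq_zero_right hmul
      rw [hrec]
      refine neg_mem (sum_mem fun k hk => Submodule.smul_mem _ _ (ih _ ?_))
      rw [Finset.mem_range] at hk
      omega

theorem aeval_mem_saturation_span_pow {α : B} {p : A[X]} (hp0 : p ≠ 0) (hp : aeval α p = 0)
    (g : A[X]) :
    aeval α g ∈ saturation (Submodule.span A ((α ^ · : ℕ → B) '' Set.Iic p.natDegree)) := by
  rw [aeval_eq_sum_range]
  exact sum_mem fun k _ => Submodule.smul_mem _ _ (pow_mem_saturation_span_pow hp0 hp k)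

variable {σ R : Type*} [CommRing R]

theorem exists_pderiv_aeval_eq (i : σ) (p : (MvPolynomial σ R)[X]) (α : MvPowerSeries σ R) :
    ∃ g : (MvPolynomial σ R)[X],
      pderiv R i (aeval α p) = aeval α g + aeval α (derivative p) * pderiv R i α := by
  induction p using Polynomial.induction_on' with
  | add p q hp hq =>
    obtain ⟨g, hg⟩ := hp
    obtain ⟨g', hg'⟩ := hq
    refine ⟨g + g', ?_⟩
    simp only [map_add, hg, hg']
    ring
  | monomial n a =>
    refine ⟨monomial n (MvPolynomial.pderiv i a), ?_⟩
    simp only [aeval_monomial, derivative_monomial, map_mul, map_natCast,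
      algebraMap_mvPolynomial_eq_coe, Derivation.leibniz, MvPowerSeries.pderiv_pow, smul_eq_mul,
      pderiv_coe]
    ring

variable [IsDomain R] [CharZero R]

-- If `p(α) = 0` then `p'(α) ∂α` is a polynomial in `α`, and `p'(α)` divides a polynomial.
theorem exists_smul_pderiv_eq_aeval_of_isAlgebraic {α : MvPowerSeries σ R}
    (hα : IsAlgebraic (MvPolynomial σ R) α) (i : σ) :
    ∃ (c : MvPolynomial σ R) (g : (MvPolynomial σ R)[X]), c ≠ 0 ∧
      c • pderiv R i α = aeval α g := by
  obtain ⟨p, hp, hder⟩ := exists_aeval_eq_zero_and_aeval_derivative_ne_zero hα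
  have haeval : IsAlgebraic (MvPolynomial σ R) (aeval α (derivative p)) :=
    Algebra.adjoin_le (S := Subalgebra.algebraicClosure _ _) (Set.singleton_subset_iff.2 hα)
      (aeval_mem_adjoin_singleton _ α)
  obtain ⟨g, c, hc, hgc⟩ :=
    exists_aeval_mul_eq_algebraMap_of_isAlgebraic haeval hder
  obtain ⟨r, hr⟩ := exists_pderiv_aeval_eq i p α
  rw [hp, map_zero] at hr
  refine ⟨c, -(g.comp (derivative p) * r), hc, ?_⟩
  rw [Algebra.smul_def, ← hgc, map_neg, map_mul, aeval_comp]
  linear_combination (-(aeval (aeval α (derivative p))) g) * hr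

theorem Holonomic.of_isAlgebraic {α : MvPowerSeries σ R}
    (hα : IsAlgebraic (MvPolynomial σ R) α) : Holonomic α := by
  obtain ⟨p, hp, hder⟩ := exists_aeval_eq_zero_and_aeval_derivative_ne_zero hα
  have hp0 : p ≠ 0 := by rintro rfl; simp at hder
  have hdeg : 1 ≤ p.natDegree := Nat.one_le_iff_ne_zero.2 fun hdeg =>
    hder (by rw [derivative_of_natDegree_zero hdeg, map_zero])
  refine ⟨_, Submodule.fg_span ((Set.finite_Iic p.natDegree).image (α ^ ·)),
    Submodule.subset_span ⟨1, hdeg, pow_one α⟩, fun i h hh => ?_⟩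
  refine pderiv_mem_of_mem_span (Submodule.subset_span.trans le_saturation) ?_ hh
  rintro _ ⟨m, -, rfl⟩
  obtain ⟨c, g, hc, hg⟩ := exists_smul_pderiv_eq_aeval_of_isAlgebraic hα i
  refine mem_saturation_of_smul_mem hc ?_
  have heval : c • pderiv R i (α ^ m) =
      aeval α ((m : (MvPolynomial σ R)[X]) * Polynomial.X ^ (m - 1) * g) := by
    rw [MvPowerSeries.pderiv_pow, ← mul_smul_comm, hg]
    simp only [map_mul, map_natCast, map_pow, aeval_X]
  exact heval ▸ aeval_mem_saturation_span_pow hp0 hp _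

end Algebraic

section DFiniteBridge

variable {σ : Type}

theorem algebraMap_eq_aeval_algebraMap_X (p : MvPolynomial σ ℚ) :
    algebraMap (MvPolynomial σ ℚ) (FractionRing (MvPowerSeries σ ℚ)) p =
      MvPolynomial.aeval (fun i => algebraMap (MvPowerSeries σ ℚ) _ (X i)) p := by
  rw [IsScalarTower.algebraMap_apply _ (MvPowerSeries σ ℚ), algebraMap_mvPolynomial_eq_coe]
  induction p using MvPolynomial.induction_on with
  | C a =>
    rw [MvPolynomial.coe_C, c_eq_algebraMap, ← IsScalarTower.algebraMap_apply,
      MvPolynomial.aeval_C]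
  | add p q hp hq => rw [MvPolynomial.coe_add, map_add, map_add, hp, hq]
  | mul_X p i hp =>
    rw [MvPolynomial.coe_mul, map_mul, map_mul, hp, MvPolynomial.coe_X, MvPolynomial.aeval_X]

theorem algebraMap_mem_ratFunField (p : MvPolynomial σ ℚ) :
    algebraMap (MvPolynomial σ ℚ) (FractionRing (MvPowerSeries σ ℚ)) p ∈ ratFunField σ := by
  rw [algebraMap_eq_aeval_algebraMap_X]
  refine IntermediateField.algebra_adjoin_le_adjoin _ _ ?_
  rw [Algebra.adjoin_range_eq_range_aeval]
  exact ⟨p, rfl⟩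

noncomputable instance : Algebra (MvPolynomial σ ℚ) (ratFunField σ) :=
  ((algebraMap (MvPolynomial σ ℚ) (FractionRing (MvPowerSeries σ ℚ))).codRestrict (ratFunField σ)
    algebraMap_mem_ratFunField).toAlgebra

instance : IsScalarTower (MvPolynomial σ ℚ) (ratFunField σ) (FractionRing (MvPowerSeries σ ℚ)) :=
  .of_algebraMap_eq fun _ => rfl

instance : FaithfulSMul (MvPolynomial σ ℚ) (ratFunField σ) :=
  .tower_bot _ _ (FractionRing (MvPowerSeries σ ℚ))

instance : IsFractionRing (MvPolynomial σ ℚ) (ratFunField σ) :=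
  .of_field _ _ fun z => by
    obtain ⟨p, q, hz⟩ := (IntermediateField.mem_adjoin_range_iff ℚ _ _).1 z.2
    rw [← algebraMap_eq_aeval_algebraMap_X, ← algebraMap_eq_aeval_algebraMap_X] at hz
    exact ⟨p, q, Subtype.ext hz⟩

theorem mem_saturation_span_iff {s : Set (MvPowerSeries σ ℚ)} {h : MvPowerSeries σ ℚ} :
    h ∈ saturation (Submodule.span (MvPolynomial σ ℚ) s) ↔
      algebraMap _ (FractionRing (MvPowerSeries σ ℚ)) h ∈ Submodule.span (ratFunField σ)
        (algebraMap _ (FractionRing (MvPowerSeries σ ℚ)) '' s) := by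
  let φ : MvPowerSeries σ ℚ →ₗ[MvPolynomial σ ℚ] FractionRing (MvPowerSeries σ ℚ) :=
    (Algebra.linearMap _ _).restrictScalars _
  have hφ : Function.Injective φ := IsFractionRing.injective _ _
  rw [IsLocalization.mem_span_iff (nonZeroDivisors (MvPolynomial σ ℚ)), mem_saturation]
  change _ ↔ ∃ y ∈ Submodule.span _ (φ '' s), ∃ z, φ h = _
  simp only [Submodule.span_image, Submodule.mem_map, exists_exists_and_eq_and]
  have clear_denom (y : MvPowerSeries σ ℚ) (z : nonZeroDivisors (MvPolynomial σ ℚ)) :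
      φ h = IsLocalization.mk' (ratFunField σ) 1 z • φ y ↔ (z : MvPolynomial σ ℚ) • h = y := by
    rw [IsFractionRing.mk'_eq_div, map_one, one_div, eq_inv_smul_iff₀, algebraMap_smul,
      ← map_smul, hφ.eq_iff]
    exact (map_ne_zero_iff _ (IsFractionRing.injective _ _)).2 (nonZeroDivisors.coe_ne_zero z)
  simp only [clear_denom]
  constructor
  · rintro ⟨q, hq, hqh⟩
    exact ⟨_, hqh, ⟨q, mem_nonZeroDivisors_of_ne_zero hq⟩, rfl⟩
  · rintro ⟨_, hm, z, rfl⟩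
    exact ⟨z, nonZeroDivisors.coe_ne_zero z, hm⟩

theorem DFiniteWrt.exists_iterate_pderiv_mem_saturation {i : σ} {F : MvPowerSeries σ ℚ}
    (hF : DFiniteWrt i F) :
    ∃ r : ℕ, (pderiv ℚ i)^[r + 1] F ∈ saturation (Submodule.span (MvPolynomial σ ℚ)
      ((fun m => (pderiv ℚ i)^[m] F) '' Set.Iic r)) := by
  let v (m : ℕ) : FractionRing (MvPowerSeries σ ℚ) := algebraMap _ _ ((pderiv ℚ i)^[m] F)
  let W := Submodule.span (ratFunField σ) (Set.range v)
  have hW : FiniteDimensional (ratFunField σ) W := hF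
  let chain : ℕ →o Submodule (ratFunField σ) W :=
    ⟨fun n => (Submodule.span (ratFunField σ) (v '' Set.Iic n)).comap W.subtype,
      fun a b hab => Submodule.comap_mono (Submodule.span_mono (Set.image_mono
        (Set.Iic_subset_Iic.2 hab)))⟩
  obtain ⟨r, hr⟩ := monotone_stabilizes_iff_noetherian.2 inferInstance chain
  refine ⟨r, mem_saturation_span_iff.2 ?_⟩
  rw [Set.image_image]
  have hmem : (⟨v (r + 1), Submodule.subset_span ⟨_, rfl⟩⟩ : W) ∈ chain (r + 1) :=
    Submodule.subset_span ⟨r + 1, Set.mem_Iic.2 le_rfl, rfl⟩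
  rwa [← hr (r + 1) (Nat.le_succ r)] at hmem

theorem DFiniteWrt.of_iterate_pderiv_mem_saturation {i : σ} {F : MvPowerSeries σ ℚ} {r : ℕ}
    (hr : (pderiv ℚ i)^[r] F ∈ saturation (Submodule.span (MvPolynomial σ ℚ)
      ((fun m => (pderiv ℚ i)^[m] F) '' Set.Iio r))) : DFiniteWrt i F := by
  set s : Set (MvPowerSeries σ ℚ) := (fun m => (pderiv ℚ i)^[m] F) '' Set.Iio r with hs
  set N := Submodule.span (MvPolynomial σ ℚ) s with hN
  have hle {m : ℕ} (hm : m ≤ r) : (pderiv ℚ i)^[m] F ∈ saturation N := by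
    rcases hm.eq_or_lt with rfl | hm
    · exact hr
    · exact le_saturation (Submodule.subset_span ⟨m, hm, rfl⟩)
  have hclosed : ∀ h ∈ saturation N, pderiv ℚ i h ∈ saturation N := by
    refine fun h => pderiv_mem_saturation le_saturation fun g hg =>
      pderiv_mem_of_mem_span (Submodule.subset_span.trans le_saturation) ?_ hg
    rintro _ ⟨m, hm, rfl⟩
    exact Function.iterate_succ_apply' (pderiv ℚ i) m F ▸ hle hm
  have hall (m : ℕ) : (pderiv ℚ i)^[m] F ∈ saturation N := by
    induction m with
    | zero => exact hle r.zero_le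
    | succ m ih => exact Function.iterate_succ_apply' (pderiv ℚ i) m F ▸ hclosed _ ih
  have : FiniteDimensional (ratFunField σ) (Submodule.span (ratFunField σ)
      (algebraMap _ (FractionRing (MvPowerSeries σ ℚ)) '' s)) :=
    FiniteDimensional.span_of_finite _ (((Set.finite_Iio r).image _).image _)
  unfold DFiniteWrt
  refine Submodule.finiteDimensional_of_le (S₂ := Submodule.span (ratFunField σ)
    (algebraMap _ (FractionRing (MvPowerSeries σ ℚ)) '' s)) (Submodule.span_le.2 ?_)
  rintro _ ⟨m, rfl⟩
  exact mem_saturation_span_iff.1 (hall m)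

theorem DFiniteWrt.of_sum_smul_iterate_pderiv_eq_zero {i : σ} {F : MvPowerSeries σ ℚ} {n : ℕ}
    (p : ℕ → MvPolynomial σ ℚ) (hp : ∃ f ∈ Finset.range n, p f ≠ 0)
    (hrel : ∑ f ∈ Finset.range n, p f • (pderiv ℚ i)^[f] F = 0) : DFiniteWrt i F := by
  induction n with
  | zero => simp only [Finset.range_zero, Finset.notMem_empty, false_and, exists_false] at hp
  | succ r ih =>
    rw [Finset.sum_range_succ] at hrel
    by_cases hr : p r = 0
    · refine ih ?_ (by rwa [hr, zero_smul, add_zero] at hrel)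
      obtain ⟨f, hf, hpf⟩ := hp
      have hfr : f ≠ r := by rintro rfl; exact hpf hr
      exact ⟨f, Finset.mem_range.2 ((Finset.mem_range_succ_iff.1 hf).lt_of_ne hfr), hpf⟩
    · refine .of_iterate_pderiv_mem_saturation (r := r) (mem_saturation.2 ⟨p r, hr, ?_⟩)
      rw [eq_neg_of_add_eq_zero_right hrel]
      exact neg_mem (sum_mem fun f hf => Submodule.smul_mem _ _
        (Submodule.subset_span ⟨f, Finset.mem_range.1 hf, rfl⟩))

end DFiniteBridge

section MixedDerivatives

variable {σ R : Type*} [CommRing R]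

instance : LeftCommutative fun (i : σ) (h : MvPowerSeries σ R) => pderiv R i h := ⟨pderiv_comm⟩

/-- The iterated derivative of `F` in which each variable is differentiated as many times as it
occurs in the multiset `w`. -/
noncomputable def mixedDeriv (F : MvPowerSeries σ R) (w : Multiset σ) : MvPowerSeries σ R :=
  w.foldr (fun i h => pderiv R i h) F

variable (F : MvPowerSeries σ R)

theorem mixedDeriv_zero : mixedDeriv F 0 = F := rfl

theorem mixedDeriv_cons (i : σ) (w : Multiset σ) :
    mixedDeriv F (i ::ₘ w) = pderiv R i (mixedDeriv F w) :=
  Multiset.foldr_cons ..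

theorem mixedDeriv_add (w w' : Multiset σ) :
    mixedDeriv F (w + w') = mixedDeriv (mixedDeriv F w') w :=
  Multiset.foldr_add ..

theorem mixedDeriv_replicate (i : σ) (n : ℕ) :
    mixedDeriv F (Multiset.replicate n i) = (pderiv R i)^[n] F := by
  induction n with
  | zero => rfl
  | succ n ih => rw [Multiset.replicate_succ, mixedDeriv_cons, ih, Function.iterate_succ_apply']

/-- The module generated by the mixed derivatives of `F` of order less than `n`. -/
noncomputable def derivFiltration (n : ℕ) : Submodule (MvPolynomial σ R) (MvPowerSeries σ R) :=
  Submodule.span _ (mixedDeriv F '' {w | w.card < n})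

variable {F}

theorem mixedDeriv_mem_derivFiltration {w : Multiset σ} {n : ℕ} (h : w.card < n) :
    mixedDeriv F w ∈ derivFiltration F n :=
  Submodule.subset_span ⟨w, h, rfl⟩

theorem derivFiltration_mono : Monotone (derivFiltration F) := fun _ _ h =>
  Submodule.span_mono (Set.image_mono fun _ hw => lt_of_lt_of_le hw h)

theorem pderiv_mem_derivFiltration_succ {h : MvPowerSeries σ R} {n : ℕ}
    (hh : h ∈ derivFiltration F n) (i : σ) : pderiv R i h ∈ derivFiltration F (n + 1) := by
  refine pderiv_mem_of_mem_span ?_ ?_ hh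
  · exact Submodule.subset_span.trans (derivFiltration_mono n.le_succ)
  · rintro _ ⟨w, hw, rfl⟩
    rw [← mixedDeriv_cons]
    exact mixedDeriv_mem_derivFiltration (Multiset.card_cons i w ▸ Nat.succ_lt_succ hw)

variable [IsDomain R]

theorem mixedDeriv_mem_saturation_derivFiltration {h : MvPowerSeries σ R} {n : ℕ}
    (hh : h ∈ saturation (derivFiltration F n)) (w : Multiset σ) :
    mixedDeriv h w ∈ saturation (derivFiltration F (n + w.card)) := by
  induction w using Multiset.induction_on with
  | empty => exact hh
  | cons i w ih =>
    rw [mixedDeriv_cons, Multiset.card_cons]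
    exact pderiv_mem_saturation ((derivFiltration_mono (Nat.le_succ _)).trans le_saturation)
      (fun g hg => le_saturation (pderiv_mem_derivFiltration_succ hg i)) ih

theorem derivFiltration_le_saturation {M : Multiset σ} [DecidableEq σ]
    (hM : ∀ i, (pderiv R i)^[M.count i + 1] F ∈ saturation (derivFiltration F (M.count i + 1)))
    (n : ℕ) :
    derivFiltration F n ≤
      saturation (Submodule.span (MvPolynomial σ R) (mixedDeriv F '' Set.Iic M)) := by
  induction n with
  | zero =>
    simp only [derivFiltration, Nat.not_lt_zero, Set.ofPred_false, Set.image_empty,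
      Submodule.span_empty, bot_le]
  | succ n ih =>
    refine Submodule.span_le.2 ?_
    rintro _ ⟨w, hw, rfl⟩
    by_cases hwM : w ≤ M
    · exact le_saturation (Submodule.subset_span ⟨w, hwM, rfl⟩)
    · obtain ⟨i, hi⟩ : ∃ i, M.count i < w.count i := by
        simpa only [Multiset.le_iff_count, not_forall, not_le] using hwM
      obtain ⟨w', rfl⟩ := Multiset.le_iff_exists_add.1 (Multiset.le_count_iff_replicate_le.1 hi)
      simp only [Set.mem_ofPred_eq, Multiset.card_add, Multiset.card_replicate] at hw
      rw [add_comm, mixedDeriv_add, mixedDeriv_replicate]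
      exact saturation_le ih (saturation_mono (derivFiltration_mono (by omega))
        (mixedDeriv_mem_saturation_derivFiltration (hM i) w'))

theorem Holonomic.of_iterate_pderiv_mem_saturation [DecidableEq σ] (M : Multiset σ)
    (hM : ∀ i, (pderiv R i)^[M.count i + 1] F ∈ saturation (derivFiltration F (M.count i + 1))) :
    Holonomic F := by
  refine ⟨_, Submodule.fg_span ((Set.finite_Iic M).image (mixedDeriv F)),
    Submodule.subset_span ⟨0, Multiset.zero_le M, mixedDeriv_zero F⟩, fun i h hh => ?_⟩
  refine pderiv_mem_of_mem_span (Submodule.subset_span.trans le_saturation) ?_ hh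
  rintro _ ⟨w, -, rfl⟩
  rw [← mixedDeriv_cons]
  exact derivFiltration_le_saturation hM _ (mixedDeriv_mem_derivFiltration (Nat.lt_succ_self _))

theorem DFinite.holonomic {σ : Type} [Finite σ] {F : MvPowerSeries σ ℚ} (hF : DFinite F) :
    Holonomic F := by
  classical
  choose r hr using fun i => (hF i).exists_iterate_pderiv_mem_saturation
  refine .of_iterate_pderiv_mem_saturation (Finsupp.toMultiset (Finsupp.equivFunOnFinite.symm r))
    fun i => ?_
  rw [Finsupp.count_toMultiset, Finsupp.equivFunOnFinite_symm_apply_apply]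
  refine saturation_mono (Submodule.span_le.2 ?_) (hr i)
  rintro _ ⟨m, hm, rfl⟩
  simp only [← mixedDeriv_replicate]
  refine mixedDeriv_mem_derivFiltration ?_
  rw [Multiset.card_replicate]
  exact Nat.lt_succ_of_le hm

end MixedDerivatives

section BoxSpan

variable {σ κ R : Type*} [Fintype σ] [CommRing R]

/-- The `R`-span of the products of the series `b k` with the monomials all of whose exponents are
at most `M`. -/
noncomputable def boxSpan (b : κ → MvPowerSeries σ R) (M : ℕ) : Submodule R (MvPowerSeries σ R) :=
  Submodule.span R (Set.range fun p : (σ → Fin (M + 1)) × κ =>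
    monomial (Finsupp.equivFunOnFinite.symm fun j => (p.1 j : ℕ)) 1 * b p.2)

variable {b : κ → MvPowerSeries σ R}

theorem monomial_mul_mem_boxSpan {M : ℕ} {a : σ →₀ ℕ} (ha : ∀ j, a j ≤ M) (k : κ) :
    monomial a 1 * b k ∈ boxSpan b M :=
  Submodule.subset_span ⟨(fun j => ⟨a j, Nat.lt_succ_of_le (ha j)⟩, k),
    congrArg (monomial · 1 * b k) (Finsupp.equivFunOnFinite.symm_apply_apply a)⟩

theorem boxSpan_le {M : ℕ} {S : Submodule R (MvPowerSeries σ R)}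
    (h : ∀ a : σ →₀ ℕ, (∀ j, a j ≤ M) → ∀ k, monomial a 1 * b k ∈ S) : boxSpan b M ≤ S := by
  refine Submodule.span_le.2 ?_
  rintro _ ⟨p, rfl⟩
  exact h _ (fun j => Nat.lt_succ_iff.1 (p.1 j).2) _

theorem boxSpan_mono : Monotone (boxSpan b) := fun _ _ h =>
  boxSpan_le fun _ ha k => monomial_mul_mem_boxSpan (fun j => (ha j).trans h) k

theorem monomial_mul_mem_boxSpan_add {M d : ℕ} {a : σ →₀ ℕ} (ha : ∀ j, a j ≤ d)
    {h : MvPowerSeries σ R} (hh : h ∈ boxSpan b M) : monomial a 1 * h ∈ boxSpan b (M + d) := by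
  suffices boxSpan b M ≤ (boxSpan b (M + d)).comap (LinearMap.mulLeft R (monomial a (1 : R))) from
    this hh
  refine boxSpan_le fun a' ha' k => ?_
  rw [Submodule.mem_comap, LinearMap.mulLeft_apply, ← mul_assoc, monomial_mul_monomial, one_mul]
  refine monomial_mul_mem_boxSpan (fun j => ?_) k
  rw [Finsupp.add_apply, add_comm]
  exact add_le_add (ha' j) (ha j)

theorem exists_mvPolynomial_smul_mem_boxSpan (p : MvPolynomial σ R) :
    ∃ d, ∀ M, ∀ h ∈ boxSpan b M, p • h ∈ boxSpan b (M + d) := by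
  induction p using MvPolynomial.induction_on' with
  | monomial u a =>
    refine ⟨∑ j, u j, fun M h hh => ?_⟩
    have hle (j : σ) : u j ≤ ∑ j, u j :=
      Finset.single_le_sum (fun _ _ => Nat.zero_le _) (Finset.mem_univ j)
    have hmem := Submodule.smul_mem _ a (monomial_mul_mem_boxSpan_add hle hh)
    rwa [← smul_mul_assoc, ← map_smul, smul_eq_mul, mul_one, ← MvPolynomial.coe_monomial,
      ← mvPolynomial_smul_eq_coe_mul] at hmem
  | add p q hp hq =>
    obtain ⟨d, hd⟩ := hp
    obtain ⟨d', hd'⟩ := hq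
    refine ⟨d + d', fun M h hh => ?_⟩
    rw [add_smul]
    exact add_mem (boxSpan_mono (by omega) (hd M h hh)) (boxSpan_mono (by omega) (hd' M h hh))

theorem exists_mem_boxSpan {h : MvPowerSeries σ R}
    (hh : h ∈ Submodule.span (MvPolynomial σ R) (Set.range b)) : ∃ d, h ∈ boxSpan b d := by
  induction hh using Submodule.span_induction with
  | mem x hx =>
    obtain ⟨k, rfl⟩ := hx
    have hmem := monomial_mul_mem_boxSpan (b := b) (M := 0) (a := 0) (fun _ => le_rfl) k
    rw [monomial_zero_one, one_mul] at hmem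
    exact ⟨0, hmem⟩
  | zero => exact ⟨0, zero_mem _⟩
  | add x y _ _ hx hy =>
    obtain ⟨d, hd⟩ := hx
    obtain ⟨d', hd'⟩ := hy
    exact ⟨d + d', add_mem (boxSpan_mono (by omega) hd) (boxSpan_mono (by omega) hd')⟩
  | smul a x _ ih =>
    obtain ⟨d, hd⟩ := ih
    obtain ⟨d', hd'⟩ := exists_mvPolynomial_smul_mem_boxSpan (b := b) a
    exact ⟨d + d', hd' d x hd⟩

theorem pderiv_monomial_one {σ : Type*} (i : σ) (a : σ →₀ ℕ) :
    pderiv R i (monomial a 1) = (a i : R) • monomial (a - Finsupp.single i 1) 1 := by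
  rw [← MvPolynomial.coe_monomial, pderiv_coe, MvPolynomial.pderiv_monomial, one_mul,
    MvPolynomial.coe_monomial, ← map_smul, smul_eq_mul, mul_one]

theorem exists_smul_pderiv_mem_boxSpan [Finite κ] {q : MvPolynomial σ R} {i : σ}
    (hq : ∀ k, q • pderiv R i (b k) ∈ Submodule.span (MvPolynomial σ R) (Set.range b)) :
    ∃ d, ∀ M, ∀ h ∈ boxSpan b M, q • pderiv R i h ∈ boxSpan b (M + d) := by
  cases nonempty_fintype κ
  obtain ⟨d, hd⟩ := exists_mvPolynomial_smul_mem_boxSpan (b := b) q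
  choose d' hd' using fun k => exists_mem_boxSpan (hq k)
  refine ⟨d + ∑ k, d' k, fun M h hh => ?_⟩
  suffices boxSpan b M ≤ (boxSpan b (M + (d + ∑ k, d' k))).comap
      ((LinearMap.mulLeft R (q : MvPowerSeries σ R)).comp (pderiv R i).toLinearMap) by
    rw [mvPolynomial_smul_eq_coe_mul]
    exact this hh
  refine boxSpan_le fun a ha k => ?_
  have hd'k : d' k ≤ ∑ k, d' k :=
    Finset.single_le_sum (f := d') (fun _ _ => Nat.zero_le _) (Finset.mem_univ k)
  rw [Submodule.mem_comap, LinearMap.comp_apply, LinearMap.mulLeft_apply, Derivation.coeFn_coe,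
    ← mvPolynomial_smul_eq_coe_mul, Derivation.leibniz, pderiv_monomial_one, smul_add, smul_eq_mul,
    smul_eq_mul, ← mul_smul_comm, mul_smul_comm (a i : R), smul_comm q]
  refine add_mem ?_ (Submodule.smul_mem _ _ ?_)
  · exact boxSpan_mono (by omega) (monomial_mul_mem_boxSpan_add ha (hd' k))
  · rw [mul_comm (b k)]
    exact boxSpan_mono (by omega)
      (hd M _ (monomial_mul_mem_boxSpan (fun j => (Nat.sub_le _ _).trans (ha j)) k))

end BoxSpan

section PoleFiltration

variable {σ R : Type*} [CommRing R]

/-- An increasing family `E` of spaces of series (the degree of a numerator being at most `M` in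
`E M`) that is stable, with degrees raised by at most `c`, under the operations that turn an
identity `q ^ n * h = g` with `g ∈ E M` into the analogous identities for `h`, `X i * h` and
`pderiv R i h` with denominator `q ^ (n + 1)`. -/
structure PoleFiltration (q : MvPolynomial σ R) (c : ℕ)
    (E : ℕ → Submodule R (MvPowerSeries σ R)) : Prop where
  mul_denom : ∀ M, ∀ h ∈ E M, q • h ∈ E (M + c)
  mul_X : ∀ i M, ∀ h ∈ E M, q • (X i * h) ∈ E (M + c)
  mul_pderiv : ∀ i M, ∀ h ∈ E M, q • pderiv R i h ∈ E (M + c)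
  pderiv_denom_mul : ∀ i M, ∀ h ∈ E M, MvPolynomial.pderiv i q • h ∈ E (M + c)

theorem exists_poleFiltration_boxSpan [Fintype σ] {κ : Type*} [Finite κ]
    {b : κ → MvPowerSeries σ R} {q : MvPolynomial σ R}
    (hq : ∀ i k, q • pderiv R i (b k) ∈ Submodule.span (MvPolynomial σ R) (Set.range b)) :
    ∃ c, PoleFiltration q c (boxSpan b) := by
  obtain ⟨c, hc⟩ := exists_mvPolynomial_smul_mem_boxSpan (b := b) q
  choose cX hX using fun i =>
    exists_mvPolynomial_smul_mem_boxSpan (b := b) (q * MvPolynomial.X i)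
  choose cd hd using fun i => exists_smul_pderiv_mem_boxSpan (hq i)
  choose cq hcq using fun i =>
    exists_mvPolynomial_smul_mem_boxSpan (b := b) (MvPolynomial.pderiv i q)
  have le_sum (f : σ → ℕ) (i : σ) : f i ≤ ∑ j, f j :=
    Finset.single_le_sum (f := f) (fun _ _ => Nat.zero_le _) (Finset.mem_univ i)
  refine ⟨c + ∑ i, cX i + ∑ i, cd i + ∑ i, cq i,
    fun M h hh => boxSpan_mono (by omega) (hc M h hh),
    fun i M h hh => boxSpan_mono (a := M + cX i) (by have := le_sum cX i; omega) ?_,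
    fun i M h hh => boxSpan_mono (by have := le_sum cd i; omega) (hd i M h hh),
    fun i M h hh => boxSpan_mono (by have := le_sum cq i; omega) (hcq i M h hh)⟩
  rw [← MvPolynomial.coe_X, ← mvPolynomial_smul_eq_coe_mul, ← mul_smul]
  exact hX i M h hh

variable {q : MvPolynomial σ R} {c : ℕ} {E : ℕ → Submodule R (MvPowerSeries σ R)} {d : ℕ}

/-- The series `h` that are quotients of an element of `E (d + c * n)` by `q ^ n`. -/
noncomputable def poleLevel (q : MvPolynomial σ R) (c : ℕ)
    (E : ℕ → Submodule R (MvPowerSeries σ R)) (d n : ℕ) : Submodule R (MvPowerSeries σ R) :=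
  (E (d + c * n)).comap (LinearMap.mulLeft R ((q : MvPowerSeries σ R) ^ n))

theorem mem_poleLevel {n : ℕ} {h : MvPowerSeries σ R} :
    h ∈ poleLevel q c E d n ↔ (q : MvPowerSeries σ R) ^ n * h ∈ E (d + c * n) := Iff.rfl

theorem mem_poleLevel_succ {n : ℕ} {h : MvPowerSeries σ R} :
    h ∈ poleLevel q c E d (n + 1) ↔ (q : MvPowerSeries σ R) ^ (n + 1) * h ∈ E (d + c * n + c) := by
  rw [mem_poleLevel, mul_add_one, ← add_assoc]

namespace PoleFiltration

theorem poleLevel_mono (hE : PoleFiltration q c E) : Monotone (poleLevel q c E d) := by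
  refine monotone_nat_of_le_succ fun n h hh => ?_
  have hqh := hE.mul_denom _ _ hh
  rwa [mvPolynomial_smul_eq_coe_mul, LinearMap.mulLeft_apply, ← mul_assoc, ← pow_succ',
    ← mem_poleLevel_succ] at hqh

theorem X_mul_mem_poleLevel (hE : PoleFiltration q c E) {n : ℕ} {h : MvPowerSeries σ R}
    (hh : h ∈ poleLevel q c E d n) (i : σ) : X i * h ∈ poleLevel q c E d (n + 1) := by
  have hXh := hE.mul_X i _ _ hh
  rwa [mvPolynomial_smul_eq_coe_mul, LinearMap.mulLeft_apply, mul_left_comm (X i), ← mul_assoc,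
    ← pow_succ', ← mem_poleLevel_succ] at hXh

theorem pderiv_mem_poleLevel (hE : PoleFiltration q c E) {n : ℕ} {h : MvPowerSeries σ R}
    (hh : h ∈ poleLevel q c E d n) (i : σ) : pderiv R i h ∈ poleLevel q c E d (n + 1) := by
  rw [mem_poleLevel] at hh
  have quotient_rule : (q : MvPowerSeries σ R) ^ (n + 1) * pderiv R i h =
      q • pderiv R i ((q : MvPowerSeries σ R) ^ n * h) -
        (n : R) • (MvPolynomial.pderiv i q • ((q : MvPowerSeries σ R) ^ n * h)) := by
    simp only [mvPolynomial_smul_eq_coe_mul, Derivation.leibniz, MvPowerSeries.pderiv_pow,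
      pderiv_coe, smul_eq_mul, smul_eq_C_mul, map_natCast]
    cases n with
    | zero => rw [Nat.cast_zero]; ring
    | succ n => rw [Nat.add_sub_cancel]; ring
  rw [mem_poleLevel_succ, quotient_rule]
  exact sub_mem (hE.mul_pderiv i _ _ hh) (Submodule.smul_mem _ _ (hE.pderiv_denom_mul i _ _ hh))

theorem iterate_pderiv_mem_poleLevel (hE : PoleFiltration q c E) {n : ℕ}
    {h : MvPowerSeries σ R} (hh : h ∈ poleLevel q c E d n) (i : σ) (f : ℕ) :
    (pderiv R i)^[f] h ∈ poleLevel q c E d (n + f) := by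
  induction f with
  | zero => exact hh
  | succ f ih =>
    rw [Function.iterate_succ_apply']
    exact hE.pderiv_mem_poleLevel ih i

theorem monomial_mul_mem_poleLevel (hE : PoleFiltration q c E) {n : ℕ} {h : MvPowerSeries σ R}
    (hh : h ∈ poleLevel q c E d n) (a : σ →₀ ℕ) :
    monomial a 1 * h ∈ poleLevel q c E d (n + a.degree) := by
  induction a using Finsupp.induction_linear generalizing n h with
  | zero => simpa only [monomial_zero_one, one_mul, map_zero, add_zero] using hh
  | add f g hf hg =>
    have hfg := hf (hg hh)
    rwa [← mul_assoc, monomial_mul_monomial, one_mul, add_assoc, add_comm g.degree,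
      ← map_add] at hfg
  | single j k =>
    rw [← X_pow_eq, Finsupp.degree_single]
    induction k with
    | zero => simpa only [pow_zero, one_mul, add_zero] using hh
    | succ k ih =>
      rw [pow_succ', mul_assoc]
      exact hE.X_mul_mem_poleLevel ih j

end PoleFiltration

end PoleFiltration

section Dimension

variable {σ κ K : Type*} [Fintype σ] [Field K] {b : κ → MvPowerSeries σ K}

instance [Finite κ] (M : ℕ) : FiniteDimensional K (boxSpan b M) :=
  FiniteDimensional.span_of_finite _ (Set.finite_range _)

theorem finrank_boxSpan_le [Fintype κ] (M : ℕ) :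
    Module.finrank K (boxSpan b M) ≤ (M + 1) ^ Fintype.card σ * Fintype.card κ := by
  classical
  refine (finrank_range_le_card _).trans_eq ?_
  rw [Fintype.card_prod, Fintype.card_fun, Fintype.card_fin]

variable [Fintype κ] {α : Type*} [Fintype α]

theorem card_le_of_linearIndependent_of_mem_boxSpan {M : ℕ} {v : α → MvPowerSeries σ K}
    (hv : LinearIndependent K v) (hmem : ∀ p, v p ∈ boxSpan b M) :
    Fintype.card α ≤ (M + 1) ^ Fintype.card σ * Fintype.card κ := by
  rw [← finrank_span_eq_card hv]
  exact (Submodule.finrank_mono (Submodule.span_le.2 (Set.range_subset_iff.2 hmem))).trans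
    (finrank_boxSpan_le M)

theorem card_le_of_linearIndependent_of_mem_poleLevel {q : MvPolynomial σ K} (hq : q ≠ 0)
    {c d n : ℕ} {v : α → MvPowerSeries σ K} (hv : LinearIndependent K v)
    (hmem : ∀ p, v p ∈ poleLevel q c (boxSpan b) d n) :
    Fintype.card α ≤ (d + c * n + 1) ^ Fintype.card σ * Fintype.card κ := by
  have hinj : Function.Injective (LinearMap.mulLeft K ((q : MvPowerSeries σ K) ^ n)) :=
    mul_right_injective₀ (pow_ne_zero _ (mt MvPolynomial.coe_eq_zero_iff.1 hq))
  exact card_le_of_linearIndependent_of_mem_boxSpan (hv.map' _ (LinearMap.ker_eq_bot.2 hinj)) hmem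

end Dimension

section EulerOperators

variable {σ R : Type*} [CommRing R]

theorem coeff_X_mul_pderiv (i : σ) (h : MvPowerSeries σ R) (n : σ →₀ ℕ) :
    coeff n (X i * pderiv R i h) = n i * coeff n h := by
  classical
  rw [X_def, coeff_monomial_mul]
  split_ifs with hle
  · have hcast : ((n i - 1 : ℕ) : R) + 1 = n i := by
      rw [← Nat.cast_add_one, Nat.sub_add_cancel (Finsupp.single_le_iff.1 hle)]
    rw [one_mul, coeff_pderiv, tsub_add_cancel_of_le hle, mul_comm, Finsupp.tsub_apply,
      Finsupp.single_eq_same, hcast]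
  · have hn : n i = 0 := by
      by_contra hn
      exact hle (Finsupp.single_le_iff.2 (Nat.one_le_iff_ne_zero.2 hn))
    rw [hn, Nat.cast_zero, zero_mul]

theorem coeff_X_pow_mul_iterate_pderiv (i : σ) (h : MvPowerSeries σ R) (f : ℕ) (n : σ →₀ ℕ) :
    coeff n (X i ^ f * (pderiv R i)^[f] h) =
      (∏ j ∈ Finset.range f, ((n i : R) - j)) * coeff n h := by
  induction f with
  | zero =>
    rw [pow_zero, Function.iterate_zero_apply, Finset.range_zero, Finset.prod_empty, one_mul,
      one_mul]
  | succ f ih =>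
    have hrec : X i ^ (f + 1) * (pderiv R i)^[f + 1] h =
        X i * pderiv R i (X i ^ f * (pderiv R i)^[f] h) -
          (f : R) • (X i ^ f * (pderiv R i)^[f] h) := by
      rw [Derivation.leibniz, MvPowerSeries.pderiv_pow, pderiv_X_self, Function.iterate_succ_apply',
        smul_eq_mul, smul_eq_mul, smul_eq_C_mul, map_natCast]
      cases f with
      | zero => rw [Nat.cast_zero]; ring
      | succ f => rw [Nat.add_sub_cancel]; ring
    rw [hrec, map_sub, coeff_X_mul_pderiv, map_smul, ih, Finset.prod_range_succ, smul_eq_mul]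
    ring

end EulerOperators

section Superdiagonal

variable {ι R : Type*}

/-- The exponent of the monomial `x ^ m` multiplied by the power `m τ + k` of an additional
variable `none`. -/
noncomputable def superdiagExp (τ : ι) (k : ℕ) (m : ι →₀ ℕ) : Option ι →₀ ℕ :=
  m.mapDomain some + Finsupp.single none (m τ + k)

theorem superdiagExp_some (τ : ι) (k : ℕ) (m : ι →₀ ℕ) (j : ι) :
    superdiagExp τ k m (some j) = m j := by
  rw [superdiagExp, Finsupp.add_apply, Finsupp.mapDomain_apply (Option.some_injective ι),
    Finsupp.single_eq_of_ne (Option.some_ne_none j), add_zero]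

theorem superdiagExp_none (τ : ι) (k : ℕ) (m : ι →₀ ℕ) : superdiagExp τ k m none = m τ + k := by
  rw [superdiagExp, Finsupp.add_apply, Finsupp.mapDomain_of_notMem_range _ _ (by simp),
    Finsupp.single_eq_same, zero_add]

theorem degree_superdiagExp_le (τ : ι) (k : ℕ) (m : ι →₀ ℕ) :
    (superdiagExp τ k m).degree ≤ 2 * m.degree + k := by
  have := Finsupp.le_degree τ m
  rw [superdiagExp, map_add, Finsupp.degree_single, Finsupp.degree_mapDomain]
  omega

theorem superdiagExp_le_iff (τ : ι) {j k : ℕ} (hjk : j ≤ k) {a m : ι →₀ ℕ} :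
    superdiagExp τ j a ≤ superdiagExp τ k m ↔ a ≤ m := by
  simp only [Finsupp.le_def, Option.forall, superdiagExp_some, superdiagExp_none]
  exact ⟨And.right, fun h => ⟨add_le_add (h τ) hjk, h⟩⟩

theorem superdiagExp_sub (τ : ι) {j k : ℕ} (hjk : j ≤ k) {a m : ι →₀ ℕ} (ham : a ≤ m) :
    superdiagExp τ k m - superdiagExp τ j a = superdiagExp τ (k - j) (m - a) := by
  have := ham τ
  ext (_ | i)
  · simp only [Finsupp.tsub_apply, superdiagExp_none]
    omega
  · simp only [Finsupp.tsub_apply, superdiagExp_some]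

variable [CommRing R]

/-- The series in which `x ^ m` has the coefficient of `x ^ m * s ^ (m τ + k)` in `G`, where `s` is
the variable `none`. -/
noncomputable def superdiagonal (τ : ι) (k : ℕ) :
    MvPowerSeries (Option ι) R →ₗ[R] MvPowerSeries ι R where
  toFun G m := coeff (superdiagExp τ k m) G
  map_add' _ _ := rfl
  map_smul' _ _ := rfl

/-- The diagonal of `G` with respect to the variables `none` and `some τ`. -/
noncomputable abbrev diagonal (τ : ι) : MvPowerSeries (Option ι) R →ₗ[R] MvPowerSeries ι R :=
  superdiagonal τ 0

theorem coeff_superdiagonal (τ : ι) (k : ℕ) (G : MvPowerSeries (Option ι) R) (m : ι →₀ ℕ) :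
    coeff m (superdiagonal τ k G) = coeff (superdiagExp τ k m) G := rfl

theorem superdiagonal_X_pow_mul_iterate_pderiv (τ i : ι) (k : ℕ) (G : MvPowerSeries (Option ι) R)
    (f : ℕ) : superdiagonal τ k (X (some i) ^ f * (pderiv R (some i))^[f] G) =
      X i ^ f * (pderiv R i)^[f] (superdiagonal τ k G) := by
  ext m
  rw [coeff_superdiagonal, coeff_X_pow_mul_iterate_pderiv, coeff_X_pow_mul_iterate_pderiv,
    coeff_superdiagonal, superdiagExp_some]

theorem superdiagonal_monomial_mul (τ : ι) {j k : ℕ} (hjk : j ≤ k) (a : ι →₀ ℕ)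
    (G : MvPowerSeries (Option ι) R) :
    superdiagonal τ k (monomial (superdiagExp τ j a) 1 * G) =
      monomial a 1 * superdiagonal τ (k - j) G := by
  classical
  ext m
  rw [coeff_superdiagonal, coeff_monomial_mul, coeff_monomial_mul]
  refine ite_congr (propext (superdiagExp_le_iff τ hjk)) (fun ham => ?_) fun _ => rfl
  rw [superdiagExp_sub τ hjk ham, coeff_superdiagonal]

/-- The operator `(D - e) ⋯ (D - 2) (D - 1)` for `D = s ∂ₛ - x_τ ∂_τ`, where `s` is the variable
`none`. The operator `D` multiplies the `k`-th superdiagonal by `k`. -/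
noncomputable def antidiagOp (τ : ι) (G : MvPowerSeries (Option ι) R) :
    ℕ → MvPowerSeries (Option ι) R
  | 0 => G
  | e + 1 => X none * pderiv R none (antidiagOp τ G e) -
      X (some τ) * pderiv R (some τ) (antidiagOp τ G e) - ((e : R) + 1) • antidiagOp τ G e

theorem superdiagonal_antidiagOp (τ : ι) (k : ℕ) (G : MvPowerSeries (Option ι) R) (e : ℕ) :
    superdiagonal τ k (antidiagOp τ G e) =
      (∏ j ∈ Finset.range e, ((k : R) - (j + 1))) • superdiagonal τ k G := by
  induction e with
  | zero => rw [antidiagOp, Finset.range_zero, Finset.prod_empty, one_smul]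
  | succ e ih =>
    have eigenvalue : superdiagonal τ k (X none * pderiv R none (antidiagOp τ G e)) -
        superdiagonal τ k (X (some τ) * pderiv R (some τ) (antidiagOp τ G e)) =
        (k : R) • superdiagonal τ k (antidiagOp τ G e) := by
      ext m
      rw [map_sub, coeff_superdiagonal, coeff_superdiagonal, coeff_X_mul_pderiv,
        coeff_X_mul_pderiv, superdiagExp_none, superdiagExp_some, map_smul, coeff_superdiagonal,
        ← sub_mul, Nat.cast_add, add_sub_cancel_left, smul_eq_mul]
    rw [antidiagOp, map_sub, map_sub, map_smul, eigenvalue, ← sub_smul, ih, smul_smul,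
      Finset.prod_range_succ, mul_comm]

/-- The terms of the linear relation from which the differential equation of a diagonal is
read off. -/
noncomputable def diagonalTerm (τ i : ι) (G : MvPowerSeries (Option ι) R) (N : ℕ) (a : ι →₀ ℕ)
    (e f : ℕ) : MvPowerSeries (Option ι) R :=
  monomial (superdiagExp τ (N - e) a) 1 *
    antidiagOp τ (X (some i) ^ f * (pderiv R (some i))^[f] G) e

theorem superdiagonal_diagonalTerm_of_lt (τ i : ι) (G : MvPowerSeries (Option ι) R) (a : ι →₀ ℕ)
    {N k e : ℕ} (f : ℕ) (hke : k < e) (heN : e ≤ N) :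
    superdiagonal τ (N - k) (diagonalTerm τ i G N a e f) = 0 := by
  have hzero : ((N - k - (N - e) : ℕ) : R) - ((e - k - 1 : ℕ) + 1) = 0 := by
    rw [← Nat.cast_add_one, show N - k - (N - e) = e - k - 1 + 1 by omega, sub_self]
  rw [diagonalTerm, superdiagonal_monomial_mul τ (by omega), superdiagonal_antidiagOp,
    Finset.prod_eq_zero (Finset.mem_range.2 (by omega : e - k - 1 < e)) hzero, zero_smul, mul_zero]

theorem superdiagonal_diagonalTerm_self (τ i : ι) (G : MvPowerSeries (Option ι) R) (a : ι →₀ ℕ)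
    (N k f : ℕ) : superdiagonal τ (N - k) (diagonalTerm τ i G N a k f) =
      (∏ j ∈ Finset.range k, (-((j : R) + 1))) •
        (monomial a 1 * (X i ^ f * (pderiv R i)^[f] (diagonal τ G))) := by
  rw [diagonalTerm, superdiagonal_monomial_mul τ le_rfl, Nat.sub_self, superdiagonal_antidiagOp,
    superdiagonal_X_pow_mul_iterate_pderiv, mul_smul_comm]
  simp only [Nat.cast_zero, zero_sub]

theorem exists_diagonal_relation [IsDomain R] [CharZero R] {A : Type*} [Fintype A]
    (a : A → ι →₀ ℕ) (τ i : ι) (G : MvPowerSeries (Option ι) R) {N : ℕ}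
    {c : A × Fin (N + 1) × Fin (N + 1) → R} (hc : ∃ p, c p ≠ 0)
    (hrel : ∑ p, c p • diagonalTerm τ i G N (a p.1) p.2.1 p.2.2 = 0) :
    ∃ k, (∃ x f, c (x, k, f) ≠ 0) ∧ ∑ f : Fin (N + 1), ∑ x, c (x, k, f) •
      (monomial (a x) 1 * (X i ^ (f : ℕ) * (pderiv R i)^[f] (diagonal τ G))) = 0 := by
  obtain ⟨k, hk, hmin⟩ : ∃ k, (∃ x f, c (x, k, f) ≠ 0) ∧ ∀ e < k, ∀ x f, c (x, e, f) = 0 := by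
    obtain ⟨⟨x, e, f⟩, hp⟩ := hc
    obtain ⟨k, hk, hmin⟩ := WellFounded.has_min (wellFounded_lt (α := Fin (N + 1)))
      {k | ∃ x f, c (x, k, f) ≠ 0} ⟨e, x, f, hp⟩
    exact ⟨k, hk, fun e he x f => by_contra fun h => hmin e ⟨x, f, h⟩ he⟩
  refine ⟨k, hk, ?_⟩
  have hproj := congrArg (superdiagonal τ (N - k)) hrel
  rw [map_sum, map_zero, Fintype.sum_prod_type, Finset.sum_comm, Fintype.sum_prod_type,
    Fintype.sum_eq_single k] at hproj
  · simp only [map_smul, superdiagonal_diagonalTerm_self, smul_comm (c _), ← Finset.smul_sum]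
      at hproj
    have hprod : ∏ j ∈ Finset.range (k : ℕ), (-((j : R) + 1)) ≠ 0 :=
      Finset.prod_ne_zero_iff.2 fun j _ => neg_ne_zero.2 (Nat.cast_add_one_ne_zero j)
    rw [smul_eq_C_mul] at hproj
    exact (mul_eq_zero.1 hproj).resolve_left
      ((map_ne_zero_iff _ MvPowerSeries.C_injective).2 hprod)
  · intro e hek
    refine Finset.sum_eq_zero fun f _ => Finset.sum_eq_zero fun x _ => ?_
    rw [map_smul]
    rcases hek.lt_or_gt with hlt | hgt
    · rw [hmin e hlt, zero_smul]
    · rw [superdiagonal_diagonalTerm_of_lt τ i G _ _ hgt (Nat.lt_succ_iff.1 e.2), smul_zero]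

end Superdiagonal

theorem DFiniteWrt.of_sum_monomial_mul_eq_zero {ι : Type} {A : Type*} [Fintype A]
    {a : A → ι →₀ ℕ} (ha : Function.Injective a) {i : ι} {F : MvPowerSeries ι ℚ} {n : ℕ}
    {c : A → Fin n → ℚ} (hc : ∃ x f, c x f ≠ 0)
    (hrel : ∑ f : Fin n, ∑ x, c x f •
      (monomial (a x) 1 * (X i ^ (f : ℕ) * (pderiv ℚ i)^[f] F)) = 0) : DFiniteWrt i F := by
  classical
  let P (f : Fin n) : MvPolynomial ι ℚ :=
    (∑ x, MvPolynomial.monomial (a x) (c x f)) * MvPolynomial.X i ^ (f : ℕ)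
  let p (f : ℕ) : MvPolynomial ι ℚ := if hf : f < n then P ⟨f, hf⟩ else 0
  have hp (f : Fin n) : p f = P f := dif_pos f.2
  obtain ⟨x₀, f₀, hc₀⟩ := hc
  refine DFiniteWrt.of_sum_smul_iterate_pderiv_eq_zero (n := n) p
    ⟨f₀, Finset.mem_range.2 f₀.2, ?_⟩ ?_
  · rw [hp]
    refine mul_ne_zero (fun h => hc₀ ?_) (pow_ne_zero _ (MvPolynomial.X_ne_zero i))
    have hcoeff := congrArg (MvPolynomial.coeff (a x₀)) h
    simpa only [MvPolynomial.coeff_sum, MvPolynomial.coeff_monomial, ha.eq_iff,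
      Finset.sum_ite_eq', Finset.mem_univ, if_true, MvPolynomial.coeff_zero] using hcoeff
  · rw [Finset.sum_range, ← hrel]
    refine Finset.sum_congr rfl fun f _ => ?_
    rw [hp, mul_smul, Finset.sum_smul]
    refine Finset.sum_congr rfl fun x _ => ?_
    rw [mvPolynomial_smul_eq_coe_mul, mvPolynomial_smul_eq_coe_mul, MvPolynomial.coe_pow,
      MvPolynomial.coe_X, MvPolynomial.coe_monomial, ← smul_mul_assoc, ← map_smul, smul_eq_mul,
      mul_one]

theorem Holonomic.exists_generators {σ R : Type*} [Finite σ] [CommRing R] [IsDomain R]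
    {G : MvPowerSeries σ R} (hG : Holonomic G) :
    ∃ (r : ℕ) (b : Fin r → MvPowerSeries σ R) (q : MvPolynomial σ R),
      q ≠ 0 ∧ G ∈ Submodule.span (MvPolynomial σ R) (Set.range b) ∧
      ∀ i k, q • pderiv R i (b k) ∈ Submodule.span (MvPolynomial σ R) (Set.range b) := by
  classical
  cases nonempty_fintype σ
  obtain ⟨N, hN, hGN, hdN⟩ := hG
  obtain ⟨r, b, rfl⟩ := Submodule.fg_iff_exists_fin_generating_family.1 hN
  choose q hq hqN using fun p : σ × Fin r =>
    mem_saturation.1 (hdN p.1 (b p.2) (Submodule.subset_span ⟨p.2, rfl⟩))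
  refine ⟨r, b, ∏ p, q p, Finset.prod_ne_zero_iff.2 fun p _ => hq p, hGN, fun i k => ?_⟩
  rw [← Finset.prod_erase_mul _ _ (Finset.mem_univ (i, k)), mul_smul]
  exact Submodule.smul_mem _ _ (hqN (i, k))

theorem exists_mul_pow_lt_pow_succ (A B l r : ℕ) :
    ∃ N, (A + B * N) ^ l * r < (N + 1) ^ (l + 1) := by
  refine ⟨(A + B) ^ l * r, ?_⟩
  set N := (A + B) ^ l * r with hN
  have hlin : A + B * N ≤ (A + B) * (N + 1) := by nlinarith [Nat.zero_le (A * N)]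
  calc (A + B * N) ^ l * r ≤ ((A + B) * (N + 1)) ^ l * r := by gcongr
    _ = (N + 1) ^ l * N := by rw [hN, mul_pow]; ring
    _ < (N + 1) ^ l * (N + 1) := by gcongr; omega
    _ = (N + 1) ^ (l + 1) := (pow_succ _ _).symm

section PoleLevel

variable {ι R : Type*} [CommRing R] {q : MvPolynomial (Option ι) R} {c d : ℕ}
  {E : ℕ → Submodule R (MvPowerSeries (Option ι) R)}

theorem PoleFiltration.antidiagOp_mem_poleLevel (hE : PoleFiltration q c E) {n : ℕ}
    {h : MvPowerSeries (Option ι) R} (hh : h ∈ poleLevel q c E d n) (τ : ι) (e : ℕ) :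
    antidiagOp τ h e ∈ poleLevel q c E d (n + 2 * e) := by
  induction e with
  | zero => exact hh
  | succ e ih =>
    exact sub_mem (sub_mem (hE.X_mul_mem_poleLevel (hE.pderiv_mem_poleLevel ih _) _)
      (hE.X_mul_mem_poleLevel (hE.pderiv_mem_poleLevel ih _) _))
      (Submodule.smul_mem _ _ (hE.poleLevel_mono (by omega) ih))

theorem PoleFiltration.diagonalTerm_mem_poleLevel (hE : PoleFiltration q c E)
    {G : MvPowerSeries (Option ι) R} (hG : G ∈ E d) (τ i : ι) {N l e f : ℕ} {a : ι →₀ ℕ}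
    (ha : a.degree ≤ l * N) (he : e ≤ N) (hf : f ≤ N) :
    diagonalTerm τ i G N a e f ∈ poleLevel q c E d ((2 * l + 5) * N) := by
  have hG₀ : G ∈ poleLevel q c E d 0 := by
    rwa [mem_poleLevel, pow_zero, one_mul, mul_zero, add_zero]
  have hmem := hE.monomial_mul_mem_poleLevel (hE.iterate_pderiv_mem_poleLevel hG₀ (some i) f)
    (Finsupp.single (some i) f)
  rw [← X_pow_eq, Finsupp.degree_single] at hmem
  refine hE.poleLevel_mono ?_
    (hE.monomial_mul_mem_poleLevel (hE.antidiagOp_mem_poleLevel hmem τ e) _)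
  have hdeg := degree_superdiagExp_le τ (N - e) a
  have hN : (2 * l + 5) * N = 2 * (l * N) + 5 * N := by ring
  omega

end PoleLevel

theorem exists_diagonalTerm_relation {ι K : Type*} [Fintype ι] [DecidableEq ι] [Field K]
    {G : MvPowerSeries (Option ι) K} (hG : Holonomic G) (τ i : ι) :
    ∃ (N : ℕ) (c : (ι → Fin (N + 1)) × Fin (N + 1) × Fin (N + 1) → K), (∃ p, c p ≠ 0) ∧
      ∑ p, c p • diagonalTerm τ i G N
        (Finsupp.equivFunOnFinite.symm fun j => (p.1 j : ℕ)) p.2.1 p.2.2 = 0 := by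
  obtain ⟨r, b, q, hq, hGb, hqb⟩ := hG.exists_generators
  obtain ⟨c, hE⟩ := exists_poleFiltration_boxSpan hqb
  obtain ⟨d, hd⟩ := exists_mem_boxSpan hGb
  set l := Fintype.card ι
  obtain ⟨N, hN⟩ := exists_mul_pow_lt_pow_succ (d + 1) (c * (2 * l + 5)) (l + 1) r
  set v : (ι → Fin (N + 1)) × Fin (N + 1) × Fin (N + 1) → MvPowerSeries (Option ι) K := fun p =>
    diagonalTerm τ i G N (Finsupp.equivFunOnFinite.symm fun j => (p.1 j : ℕ)) p.2.1 p.2.2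
  have hdeg (x : ι → Fin (N + 1)) :
      (Finsupp.equivFunOnFinite.symm fun j => (x j : ℕ)).degree ≤ l * N := by
    rw [Finsupp.degree_eq_sum]
    exact Finset.sum_le_card_nsmul _ _ N fun j _ => Nat.lt_succ_iff.1 (x j).2
  have hv (p) : v p ∈ poleLevel q c (boxSpan b) d ((2 * l + 5) * N) :=
    hE.diagonalTerm_mem_poleLevel hd τ i (hdeg p.1) (Nat.lt_succ_iff.1 p.2.1.2)
      (Nat.lt_succ_iff.1 p.2.2.2)
  suffices ¬LinearIndependent K v by
    obtain ⟨g, hg, hne⟩ := Fintype.not_linearIndependent_iff.1 this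
    exact ⟨N, g, hne, hg⟩
  refine fun hindep => hN.not_ge ?_
  have hcard := card_le_of_linearIndependent_of_mem_poleLevel hq hindep hv
  rw [Fintype.card_prod, Fintype.card_prod, Fintype.card_fun, Fintype.card_fin,
    Fintype.card_option, Fintype.card_fin] at hcard
  calc (N + 1) ^ (l + 1 + 1) = (N + 1) ^ l * ((N + 1) * (N + 1)) := by ring
    _ ≤ (d + c * ((2 * l + 5) * N) + 1) ^ (l + 1) * r := hcard
    _ = (d + 1 + c * (2 * l + 5) * N) ^ (l + 1) * r := by ring

theorem Holonomic.dFinite_diagonal {ι : Type} [Finite ι] (τ : ι)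
    {G : MvPowerSeries (Option ι) ℚ} (hG : Holonomic G) : DFinite (diagonal τ G) := by
  classical
  cases nonempty_fintype ι
  intro i
  obtain ⟨N, c, hc, hrel⟩ := exists_diagonalTerm_relation hG τ i
  obtain ⟨k, hk, hdiag⟩ := exists_diagonal_relation
    (fun x : ι → Fin (N + 1) => Finsupp.equivFunOnFinite.symm fun j => (x j : ℕ)) τ i G hc hrel
  refine DFiniteWrt.of_sum_monomial_mul_eq_zero (c := fun x f => c (x, k, f)) (fun x y hxy => ?_)
    hk hdiag
  ext j
  exact DFunLike.congr_fun hxy j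

section CoeffX

variable {σ R : Type*} [CommSemiring R]

theorem coeff_add_single_X_mul (j : σ) (F : MvPowerSeries σ R) (n : σ →₀ ℕ) :
    coeff (n + Finsupp.single j 1) (X j * F) = coeff n F := by
  rw [add_comm, X_def, coeff_add_monomial_mul, one_mul]

theorem coeff_X_mul_of_eq_zero {j : σ} (F : MvPowerSeries σ R) {n : σ →₀ ℕ} (hn : n j = 0) :
    coeff n (X j * F) = 0 := by
  classical
  rw [X_def, coeff_monomial_mul, if_neg fun h => by simpa [hn] using h j]

theorem X_mul_eq_of_coeff {j : σ} {F G : MvPowerSeries σ R}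
    (hzero : ∀ n, n j = 0 → coeff n G = 0)
    (hsucc : ∀ n, coeff (n + Finsupp.single j 1) G = coeff n F) : X j * F = G := by
  ext n
  by_cases hn : n j = 0
  · rw [coeff_X_mul_of_eq_zero F hn, hzero n hn]
  · obtain ⟨n, rfl⟩ := exists_add_of_le (Finsupp.single_le_iff.2 (Nat.one_le_iff_ne_zero.2 hn))
    rw [add_comm, coeff_add_single_X_mul, hsucc]

end CoeffX

section KernelMethod

theorem kernel_factorization {R : Type*} [CommRing R] {a b c t A : R}
    (hA : (1 - t * b) * A = 1 + t ^ 2 * a * c * A ^ 2) (x : R) :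
    x - t * (a + b * x + c * x ^ 2) =
      (x - t * a * A) * (1 - t * b - t * c * x - t ^ 2 * a * c * A) := by
  linear_combination t * a * hA

theorem isAlgebraic_of_quadratic {R S : Type*} [CommRing R] [CommRing S] [IsDomain R]
    [NoZeroDivisors S] [Algebra R S] [FaithfulSMul R S] {g e A : S}
    (hg : IsAlgebraic R g) (he : IsAlgebraic R e) (hA : g * A = 1 + e * A ^ 2) :
    IsAlgebraic R A := by
  have : Nontrivial S := (FaithfulSMul.algebraMap_injective R S).nontrivial
  let T := Subalgebra.algebraicClosure R S
  let g' : T := ⟨g, hg⟩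
  let e' : T := ⟨e, he⟩
  refine IsAlgebraic.restrictScalars R (S := T)
    ⟨Polynomial.C e' * Polynomial.X ^ 2 - Polynomial.C g' * Polynomial.X + 1, fun h => ?_, ?_⟩
  · simpa using congrArg (Polynomial.coeff · 0) h
  · simp only [map_add, map_sub, map_mul, map_pow, Polynomial.aeval_C, Polynomial.aeval_X, map_one]
    change e * A ^ 2 - g * A + 1 = 0
    linear_combination -hA

theorem isAlgebraic_coe {σ R : Type*} [CommRing R] [Nontrivial R] (p : MvPolynomial σ R) :
    IsAlgebraic (MvPolynomial σ R) (p : MvPowerSeries σ R) := by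
  rw [← algebraMap_mvPolynomial_eq_coe]
  exact isAlgebraic_algebraMap p

theorem isAlgebraic_X {σ R : Type*} [CommRing R] [Nontrivial R] (i : σ) :
    IsAlgebraic (MvPolynomial σ R) (X i : MvPowerSeries σ R) := by
  rw [← MvPolynomial.coe_X]
  exact isAlgebraic_coe _

variable {σ K : Type*} [Field K]

theorem isAlgebraic_inv_of_constantCoeff_ne_zero {D : MvPowerSeries σ K}
    (hD : IsAlgebraic (MvPolynomial σ K) D) (hD₀ : constantCoeff D ≠ 0) :
    IsAlgebraic (MvPolynomial σ K) D⁻¹ := by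
  let inst : Invertible D :=
    ⟨D⁻¹, MvPowerSeries.inv_mul_cancel D hD₀, MvPowerSeries.mul_inv_cancel D hD₀⟩
  exact hD.invOf

theorem exists_mul_eq_one_add_mul_sq {g e : MvPowerSeries σ K} (hg : constantCoeff g ≠ 0)
    (he : constantCoeff e = 0) : ∃ A, g * A = 1 + e * A ^ 2 := by
  have hgi : g * g⁻¹ = 1 := MvPowerSeries.mul_inv_cancel g hg
  have hsubst : PowerSeries.HasSubst (e * g⁻¹ ^ 2) :=
    PowerSeries.HasSubst.of_constantCoeff_zero (by rw [map_mul, he, zero_mul])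
  set c : MvPowerSeries σ K := PowerSeries.substAlgHom hsubst
    (PowerSeries.catalanSeries.map (Nat.castRingHom K))
  have hcatalan : c ^ 2 * (e * g⁻¹ ^ 2) + 1 = c := by
    have h := congrArg (PowerSeries.substAlgHom hsubst ∘ PowerSeries.map (Nat.castRingHom K))
      PowerSeries.catalanSeries_sq_mul_X_add_one
    simpa only [Function.comp_apply, map_add, map_mul, map_pow, map_one, PowerSeries.map_X,
      PowerSeries.substAlgHom_X] using h
  exact ⟨g⁻¹ * c, by linear_combination c * hgi - hcatalan⟩

theorem pderiv_eq_zero_of_mul_eq_one_add_mul_sq {x : σ} {g e A : MvPowerSeries σ K}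
    (hg : constantCoeff g ≠ 0) (he : constantCoeff e = 0) (hgx : pderiv K x g = 0)
    (hex : pderiv K x e = 0) (hA : g * A = 1 + e * A ^ 2) : pderiv K x A = 0 := by
  have hderiv := congrArg (pderiv K x) hA
  simp only [Derivation.leibniz, map_add, Derivation.leibniz_pow, hgx, hex,
    Derivation.map_one_eq_zero, smul_eq_mul, mul_zero, add_zero, zero_add, nsmul_eq_mul] at hderiv
  have hprod : (g - 2 * e * A) * pderiv K x A = 0 := by
    push_cast at hderiv
    linear_combination hderiv
  refine (mul_eq_zero.1 hprod).resolve_left fun h => hg ?_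
  have hconst := congrArg constantCoeff h
  rwa [map_sub, map_mul, map_mul, he, mul_zero, zero_mul, sub_zero, map_zero] at hconst

variable [CharZero K]

theorem pderiv_eq_zero_iff {x : σ} {B : MvPowerSeries σ K} :
    pderiv K x B = 0 ↔ ∀ m, coeff (m + Finsupp.single x 1) B = 0 := by
  rw [MvPowerSeries.ext_iff]
  refine forall_congr' fun m => ?_
  rw [coeff_pderiv, map_zero, mul_eq_zero, or_iff_left (Nat.cast_add_one_ne_zero _)]

theorem eq_zero_of_pderiv_kernel_mul_eq_zero {x t : σ} (hxt : x ≠ t) {S E : MvPowerSeries σ K}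
    (hE : pderiv K x ((X x - X t * S) * E) = 0) : E = 0 := by
  rw [pderiv_eq_zero_iff] at hE
  have hdvd (n : ℕ) : X t ^ n ∣ E := by
    induction n with
    | zero => exact one_dvd E
    | succ n ih =>
      rw [X_pow_dvd_iff]
      intro m hm
      have hdvd_succ : X t ^ (n + 1) ∣ X t * S * E := by
        rw [pow_succ', mul_assoc]
        exact mul_dvd_mul_left _ (ih.mul_left S)
      have hzero : coeff (m + Finsupp.single x 1) (X t * S * E) = 0 :=
        X_pow_dvd_iff.1 hdvd_succ _
          (by rwa [Finsupp.add_apply, Finsupp.single_eq_of_ne hxt.symm, add_zero])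
      have hm := hE m
      rwa [sub_mul, map_sub, hzero, sub_zero, coeff_add_single_X_mul] at hm
  ext m
  exact X_pow_dvd_iff.1 (hdvd (m t + 1)) m (Nat.lt_succ_self _)

/-- The hypothesis `hF` is the functional equation of walks on the half-line whose steps `-1`, `0`,
`1` have the weights `a`, `b`, `c`: its left-hand side counts the walks about to exit at `-1`. -/
theorem isAlgebraic_of_kernel_equation {x t : σ} (hxt : x ≠ t) {a b c : MvPowerSeries σ K}
    (ha : IsAlgebraic (MvPolynomial σ K) a) (hb : IsAlgebraic (MvPolynomial σ K) b)
    (hc : IsAlgebraic (MvPolynomial σ K) c) (hax : pderiv K x a = 0) (hbx : pderiv K x b = 0)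
    (hcx : pderiv K x c = 0) {F : MvPowerSeries σ K}
    (hF : pderiv K x ((X x - X t * (a + b * X x + c * X x ^ 2)) * F - X x) = 0) :
    IsAlgebraic (MvPolynomial σ K) F := by
  have htx : pderiv K x (X t : MvPowerSeries σ K) = 0 := pderiv_X_of_ne hxt.symm
  have hg₀ : constantCoeff (1 - X t * b : MvPowerSeries σ K) ≠ 0 := by simp
  have he₀ : constantCoeff (X t ^ 2 * a * c : MvPowerSeries σ K) = 0 := by simp
  have ht := isAlgebraic_X (R := K) t
  have hg := isAlgebraic_one.sub (ht.mul hb)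
  have he := ((ht.pow 2).mul ha).mul hc
  obtain ⟨A, hA⟩ := exists_mul_eq_one_add_mul_sq hg₀ he₀
  have hAx : pderiv K x A = 0 := by
    refine pderiv_eq_zero_of_mul_eq_one_add_mul_sq hg₀ he₀ ?_ ?_ hA <;>
      simp [Derivation.leibniz, Derivation.leibniz_pow, htx, hax, hbx, hcx]
  set D : MvPowerSeries σ K := 1 - X t * b - X t * c * X x - X t ^ 2 * a * c * A with hD
  have hD₀ : constantCoeff D ≠ 0 := by simp [hD]
  have hDalg : IsAlgebraic (MvPolynomial σ K) D :=
    (hg.sub ((ht.mul hc).mul (isAlgebraic_X x))).sub (he.mul (isAlgebraic_of_quadratic hg he hA))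
  have hDinv : (X x - X t * (a + b * X x + c * X x ^ 2)) * D⁻¹ = X x - X t * a * A := by
    rw [kernel_factorization hA, mul_assoc, ← hD, MvPowerSeries.mul_inv_cancel D hD₀, mul_one]
  have hE : pderiv K x ((X x - X t * (a + b * X x + c * X x ^ 2)) * (F - D⁻¹)) = 0 := by
    rw [mul_sub, hDinv, ← sub_add, map_add, hF]
    simp [Derivation.leibniz, htx, hax, hAx]
  rw [sub_eq_zero.1 (eq_zero_of_pderiv_kernel_mul_eq_zero hxt hE)]
  exact isAlgebraic_inv_of_constantCoeff_ne_zero hDalg hD₀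

end KernelMethod

section StepCount

variable {α Γ : Type*} [AddCommGroup Γ]

/-- The lists of `n` letters of `Ω` with displacements `φ` whose partial sums all lie in `P` and
whose total displacement is `γ`. -/
def confinedWalks (Ω : Set α) (φ : α → Γ) (P : Set Γ) (γ : Γ) (n : ℕ) : Set (List α) :=
  {w | (∀ s ∈ w, s ∈ Ω) ∧ (∀ p, p <+: w → (p.map φ).sum ∈ P) ∧ w.length = n ∧ (w.map φ).sum = γ}

/-- The number of walks in `confinedWalks Ω φ P γ n`. -/
noncomputable def stepCount (Ω : Set α) (φ : α → Γ) (P : Set Γ) (γ : Γ) (n : ℕ) : ℕ :=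
  (confinedWalks Ω φ P γ n).ncard

variable {Ω : Set α} {φ : α → Γ} {P : Set Γ}

theorem confinedWalks_of_notMem {γ : Γ} (hγ : γ ∉ P) (n : ℕ) : confinedWalks Ω φ P γ n = ∅ :=
  Set.eq_empty_of_forall_notMem fun w ⟨_, hconf, _, hsum⟩ =>
    hγ (hsum ▸ hconf w List.prefix_rfl)

theorem confinedWalks_zero (hP : 0 ∈ P) : confinedWalks Ω φ P 0 0 = {[]} := by
  ext w
  constructor
  · exact fun hw => List.eq_nil_of_length_eq_zero hw.2.2.1
  · rintro rfl
    refine ⟨by simp, fun p hp => ?_, rfl, by simp⟩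
    rwa [List.prefix_nil.1 hp, List.map_nil, List.sum_nil]

theorem confinedWalks_zero_of_ne_zero {γ : Γ} (hγ : γ ≠ 0) : confinedWalks Ω φ P γ 0 = ∅ := by
  refine Set.eq_empty_of_forall_notMem fun w ⟨_, _, hlen, hsum⟩ => hγ ?_
  rw [← hsum, List.eq_nil_of_length_eq_zero hlen, List.map_nil, List.sum_nil]

theorem confinedWalks_succ {γ : Γ} (hγ : γ ∈ P) (n : ℕ) :
    confinedWalks Ω φ P γ (n + 1) =
      ⋃ s ∈ Ω, (fun w => w ++ [s]) '' confinedWalks Ω φ P (γ - φ s) n := by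
  ext w
  simp only [Set.mem_iUnion, Set.mem_image, exists_prop]
  constructor
  · rintro ⟨hsteps, hconf, hlen, hsum⟩
    rcases List.eq_nil_or_concat' w with rfl | ⟨w, s, rfl⟩
    · simp at hlen
    · exact ⟨s, hsteps s (by simp), w, ⟨fun s' hs' => hsteps s' (by simp [hs']),
        fun p hp => hconf p (hp.trans (List.prefix_append _ _)), by simpa using hlen,
        by simp [← hsum]⟩, rfl⟩
  · rintro ⟨s, hs, w, ⟨hsteps, hconf, hlen, hsum⟩, rfl⟩
    have hsum' : ((w ++ [s]).map φ).sum = γ := by simp [hsum]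
    refine ⟨fun s' hs' => ?_, fun p hp => ?_, by simp [hlen], hsum'⟩
    · rcases List.mem_append.1 hs' with h | h
      · exact hsteps s' h
      · rwa [List.mem_singleton.1 h]
    · rcases List.prefix_concat_iff.1 hp with rfl | h
      · rwa [hsum']
      · exact hconf p h

theorem finite_confinedWalks (hΩ : Ω.Finite) (γ : Γ) (n : ℕ) :
    (confinedWalks Ω φ P γ n).Finite := by
  induction n generalizing γ with
  | zero =>
    exact (Set.finite_singleton []).subset fun _ hw => List.eq_nil_of_length_eq_zero hw.2.2.1
  | succ n ih =>
    by_cases hγ : γ ∈ P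
    · rw [confinedWalks_succ hγ]
      exact hΩ.biUnion fun s _ => (ih _).image _
    · rw [confinedWalks_of_notMem hγ]
      exact Set.finite_empty

theorem stepCount_of_notMem {γ : Γ} (hγ : γ ∉ P) (n : ℕ) : stepCount Ω φ P γ n = 0 := by
  rw [stepCount, confinedWalks_of_notMem hγ, Set.ncard_empty]

open Classical in
theorem stepCount_zero (hP : 0 ∈ P) (γ : Γ) : stepCount Ω φ P γ 0 = if γ = 0 then 1 else 0 := by
  split_ifs with hγ
  · rw [hγ, stepCount, confinedWalks_zero hP, Set.ncard_singleton]
  · rw [stepCount, confinedWalks_zero_of_ne_zero hγ, Set.ncard_empty]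

theorem stepCount_succ (hΩ : Ω.Finite) {γ : Γ} (hγ : γ ∈ P) (n : ℕ) :
    stepCount Ω φ P γ (n + 1) = ∑ s ∈ hΩ.toFinset, stepCount Ω φ P (γ - φ s) n := by
  have hdisj : Set.PairwiseDisjoint Ω fun s =>
      (fun w => w ++ [s]) '' confinedWalks Ω φ P (γ - φ s) n := by
    intro s _ s' _ hss'
    rw [Function.onFun, Set.disjoint_left]
    rintro _ ⟨w, -, rfl⟩ ⟨w', -, hw'⟩
    exact hss' (List.singleton_injective (List.append_inj_right' hw' rfl)).symm
  rw [stepCount, confinedWalks_succ hγ, hΩ.ncard_biUnion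
    (fun s _ => (finite_confinedWalks hΩ _ _).image _) hdisj,
    finsum_mem_eq_finite_toFinset_sum _ hΩ]
  exact Finset.sum_congr rfl fun s _ =>
    Set.ncard_image_of_injective _ (List.append_left_injective [s])

end StepCount

section WalkCounts

theorem finite_smallSteps (D : ℕ) : (smallSteps D).Finite :=
  Set.Finite.pi' fun _ => Set.toFinite _

/-- The number of walks confined to the orthant with a given end point; unlike in `walkCount`, the
end point is integral, so that recurrences need no case distinction at the boundary. -/
noncomputable def intWalkCount {D : ℕ} (S : Set (Fin D → ℤ)) (e : Fin D → ℤ) (n : ℕ) : ℕ :=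
  stepCount S id (Set.Ici 0) e n

theorem walkCount_eq_intWalkCount {D : ℕ} (S : Set (Fin D → ℤ)) (e : Fin D → ℕ) (n : ℕ) :
    walkCount S e n = intWalkCount S (fun i => (e i : ℤ)) n := by
  rw [walkCount, intWalkCount, stepCount]
  congr 1
  ext w
  simp [orthantWalks, confinedWalks, and_assoc]

theorem coeff_walkGF {D : ℕ} (S : Set (Fin D → ℤ)) (m : Fin D ⊕ Unit →₀ ℕ) :
    coeff m (walkGF S) = (intWalkCount S (fun i => (m (Sum.inl i) : ℤ)) (m (Sum.inr ())) : ℚ) :=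
  congrArg Nat.cast (walkCount_eq_intWalkCount S _ _)

theorem intWalkCount_of_not_nonneg {D : ℕ} (S : Set (Fin D → ℤ)) {e : Fin D → ℤ} (he : ¬0 ≤ e)
    (n : ℕ) : intWalkCount S e n = 0 :=
  stepCount_of_notMem he n

theorem intWalkCount_zero {D : ℕ} (S : Set (Fin D → ℤ)) (e : Fin D → ℤ) :
    intWalkCount S e 0 = if e = 0 then 1 else 0 := by
  rw [intWalkCount, stepCount_zero Set.self_mem_Ici]
  congr

theorem intWalkCount_succ {D : ℕ} {S : Set (Fin D → ℤ)} (hS : S.Finite) {e : Fin D → ℤ}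
    (he : 0 ≤ e) (n : ℕ) :
    intWalkCount S e (n + 1) = ∑ s ∈ hS.toFinset, intWalkCount S (e - s) n :=
  stepCount_succ hS he n

variable {d δ : ℕ} {U V : Set (Fin d → ℤ)} {T : Set (Fin δ → ℤ)}

/-- The steps of coloured `(U, V)`-walks: white steps of `U` and black steps of `V`. -/
def colouredSteps (U V : Set (Fin d → ℤ)) : Set ((Fin d → ℤ) × Bool) :=
  {s | s.1 ∈ U ∧ s.2 = false ∨ s.1 ∈ V ∧ s.2 = true}

/-- The number of coloured walks with `n` steps, `k` of them black, that end at `e`. Black steps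
are counted by an additional coordinate of the displacement. -/
noncomputable def intColouredCount (U V : Set (Fin d → ℤ)) (e : Fin d → ℤ) (k : ℤ) (n : ℕ) : ℕ :=
  stepCount (colouredSteps U V) (fun s => (s.1, if s.2 then (1 : ℤ) else 0))
    {γ : (Fin d → ℤ) × ℤ | 0 ≤ γ.1} (e, k) n

theorem mem_colouredSteps_iff {s : (Fin d → ℤ) × Bool} :
    s ∈ colouredSteps U V ↔
      s.1 ∈ U ∪ V ∧ (s.1 ∈ U \ V → s.2 = false) ∧ (s.1 ∈ V \ U → s.2 = true) := by
  obtain ⟨s, colour⟩ := s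
  cases colour <;> simp [colouredSteps] <;> tauto

theorem finite_colouredSteps (hU : U.Finite) (hV : V.Finite) : (colouredSteps U V).Finite := by
  refine ((hU.union hV).prod (Set.finite_univ (α := Bool))).subset ?_
  rintro s (⟨hs, -⟩ | ⟨hs, -⟩)
  · exact ⟨Or.inl hs, trivial⟩
  · exact ⟨Or.inr hs, trivial⟩

theorem sum_colouredSteps {M : Type*} [AddCommMonoid M] (hU : U.Finite) (hV : V.Finite)
    (g : (Fin d → ℤ) × Bool → M) :
    ∑ s ∈ (finite_colouredSteps hU hV).toFinset, g s =
      ∑ u ∈ hU.toFinset, g (u, false) + ∑ v ∈ hV.toFinset, g (v, true) := by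
  classical
  have hsteps : (finite_colouredSteps hU hV).toFinset =
      hU.toFinset.image (fun u => (u, false)) ∪ hV.toFinset.image (fun v => (v, true)) := by
    ext ⟨s, colour⟩
    cases colour <;> simp [colouredSteps]
  rw [hsteps, Finset.sum_union (by rw [Finset.disjoint_left]; simp), Finset.sum_image (by simp),
    Finset.sum_image (by simp)]

theorem sum_map_displacement (w : List ((Fin d → ℤ) × Bool)) :
    (w.map fun s => (s.1, if s.2 then (1 : ℤ) else 0)).sum =
      ((w.map Prod.fst).sum, ((w.map Prod.snd).count true : ℤ)) := by
  induction w with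
  | nil => rfl
  | cons s w ih =>
    obtain ⟨s, colour⟩ := s
    cases colour <;> simp [ih, add_comm]

theorem colouredCount_eq_intColouredCount (U V : Set (Fin d → ℤ)) (e : Fin d → ℕ) (k n : ℕ) :
    colouredCount U V e k n = intColouredCount U V (fun i => (e i : ℤ)) k n := by
  rw [colouredCount, intColouredCount, stepCount]
  congr 1
  ext w
  simp only [colouredWalks, orthantWalks, confinedWalks, Set.mem_ofPred_eq, sum_map_displacement,
    mem_colouredSteps_iff, Prod.mk.injEq, Nat.cast_inj, List.forall_mem_map]
  constructor
  · rintro ⟨⟨⟨hsteps, hconf⟩, hcolour⟩, hlen, hblack, hsum⟩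
    exact ⟨fun s hs => ⟨hsteps s hs, hcolour s hs⟩, fun p hp => hconf _ (hp.map _), hlen, hsum,
      hblack⟩
  · rintro ⟨hsteps, hconf, hlen, hsum, hblack⟩
    refine ⟨⟨⟨fun s hs => (hsteps s hs).1, fun p hp => ?_⟩, fun s hs => (hsteps s hs).2⟩, hlen,
      hblack, hsum⟩
    obtain ⟨q, hq, rfl⟩ := List.prefix_map_iff.1 hp
    exact hconf q hq

theorem coeff_colouredGF (U V : Set (Fin d → ℤ)) (m : Fin d ⊕ Fin 2 →₀ ℕ) :
    coeff m (colouredGF U V) =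
      (intColouredCount U V (fun i => (m (Sum.inl i) : ℤ)) (m (Sum.inr 0)) (m (Sum.inr 1)) : ℚ) :=
  congrArg Nat.cast (colouredCount_eq_intColouredCount U V _ _ _)

theorem intColouredCount_of_not_nonneg {e : Fin d → ℤ} (he : ¬0 ≤ e) (k : ℤ) (n : ℕ) :
    intColouredCount U V e k n = 0 :=
  stepCount_of_notMem he n

open Classical in
theorem intColouredCount_zero (e : Fin d → ℤ) (k : ℤ) :
    intColouredCount U V e k 0 = if e = 0 ∧ k = 0 then 1 else 0 := by
  rw [intColouredCount, stepCount_zero (by simp)]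
  simp [Prod.ext_iff]

theorem intColouredCount_succ (hU : U.Finite) (hV : V.Finite) {e : Fin d → ℤ} (he : 0 ≤ e)
    (k : ℤ) (n : ℕ) :
    intColouredCount U V e k (n + 1) = ∑ u ∈ hU.toFinset, intColouredCount U V (e - u) k n +
      ∑ v ∈ hV.toFinset, intColouredCount U V (e - v) (k - 1) n := by
  rw [intColouredCount, stepCount_succ (finite_colouredSteps hU hV) he, sum_colouredSteps hU hV]
  simp [intColouredCount]

theorem intColouredCount_of_notMem_Icc (hU : U.Finite) (hV : V.Finite) (e : Fin d → ℤ) {k : ℤ}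
    {n : ℕ} (hk : k ∉ Set.Icc 0 (n : ℤ)) : intColouredCount U V e k n = 0 := by
  rw [Set.mem_Icc] at hk
  induction n generalizing e k with
  | zero => exact (intColouredCount_zero e k).trans (if_neg (by push_cast at hk; omega))
  | succ n ih =>
    by_cases he : 0 ≤ e
    · push_cast at hk
      rw [intColouredCount_succ hU hV he, Finset.sum_eq_zero fun u _ => ih _ (by omega),
        Finset.sum_eq_zero fun v _ => ih _ (by omega), add_zero]
    · exact intColouredCount_of_not_nonneg he _ _

end WalkCounts

section HadamardCounts

open Finset.HasAntidiagonal (antidiagonal)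

variable {d δ : ℕ}

theorem append_nonneg_iff {i : Fin d → ℤ} {j : Fin δ → ℤ} :
    0 ≤ Fin.append i j ↔ 0 ≤ i ∧ 0 ≤ j := by
  simp [Pi.le_def, Fin.forall_fin_add]

theorem append_eq_zero_iff {i : Fin d → ℤ} {j : Fin δ → ℤ} :
    Fin.append i j = 0 ↔ i = 0 ∧ j = 0 := by
  simp [funext_iff, Fin.forall_fin_add]

theorem append_sub_append (i i' : Fin d → ℤ) (j j' : Fin δ → ℤ) :
    Fin.append i j - Fin.append i' j' = Fin.append (i - i') (j - j') := by
  simp [funext_iff, Fin.forall_fin_add]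

theorem append_injective : Function.Injective
    fun p : (Fin d → ℤ) × (Fin δ → ℤ) => Fin.append p.1 p.2 := by
  rintro ⟨i, j⟩ ⟨i', j'⟩ h
  simpa [funext_iff, Fin.forall_fin_add] using h

variable {U V : Set (Fin d → ℤ)} {T : Set (Fin δ → ℤ)}

theorem finite_hadamardSteps (hU : U.Finite) (hV : V.Finite) (hT : T.Finite) :
    (hadamardSteps U V T).Finite :=
  (hU.image2 _ (Set.finite_singleton _)).union (hV.image2 _ hT)

theorem sum_hadamardSteps {M : Type*} [AddCommMonoid M] (hU : U.Finite) (hV : V.Finite)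
    (hT : T.Finite) (h0 : 0 ∉ T) (g : (Fin (d + δ) → ℤ) → M) :
    ∑ s ∈ (finite_hadamardSteps hU hV hT).toFinset, g s =
      ∑ u ∈ hU.toFinset, g (Fin.append u 0) +
        ∑ v ∈ hV.toFinset, ∑ τ ∈ hT.toFinset, g (Fin.append v τ) := by
  classical
  have hsteps : (finite_hadamardSteps hU hV hT).toFinset =
      (hU.toFinset ×ˢ {0} ∪ hV.toFinset ×ˢ hT.toFinset).image fun p => Fin.append p.1 p.2 := by
    ext s
    simp only [hadamardSteps, Set.Finite.mem_toFinset, Set.mem_union, Set.mem_image2,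
      Finset.mem_union, Finset.mem_image, Finset.mem_product, Prod.exists, Set.mem_singleton_iff,
      Finset.mem_singleton, or_and_right, exists_or, and_assoc, exists_and_left]
  have hdisj : Disjoint (hU.toFinset ×ˢ {0}) (hV.toFinset ×ˢ hT.toFinset) :=
    Finset.disjoint_product.2 (Or.inr (by simpa using h0))
  rw [hsteps, Finset.sum_image append_injective.injOn, Finset.sum_union hdisj, Finset.sum_product,
    Finset.sum_product]
  simp only [Finset.sum_singleton]

theorem sum_antidiagonal_succ_intColouredCount_mul (hU : U.Finite) (hV : V.Finite)
    (i : Fin d → ℤ) (n : ℕ) (f : ℕ → ℕ) :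
    ∑ p ∈ antidiagonal (n + 1), intColouredCount U V i p.1 n * f p.2 =
      ∑ p ∈ antidiagonal n, intColouredCount U V i p.1 n * f (p.2 + 1) := by
  rw [Finset.Nat.sum_antidiagonal_succ', intColouredCount_of_notMem_Icc hU hV _ (by simp), zero_mul,
    zero_add]

theorem sum_antidiagonal_succ_intColouredCount_sub_one_mul (hU : U.Finite) (hV : V.Finite)
    (i : Fin d → ℤ) (n : ℕ) (f : ℕ → ℕ) :
    ∑ p ∈ antidiagonal (n + 1), intColouredCount U V i (p.1 - 1) n * f p.2 =
      ∑ p ∈ antidiagonal n, intColouredCount U V i p.1 n * f p.2 := by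
  rw [Finset.Nat.sum_antidiagonal_succ, intColouredCount_of_notMem_Icc hU hV _ (by simp), zero_mul,
    zero_add]
  simp only [Nat.cast_add, Nat.cast_one, add_sub_cancel_right]

/-- A Hadamard walk is a walk with steps `U ∪ V` whose steps taken from `V` carry the steps of a
walk on `T`. The steps taken from `U` are the black ones here, whence the order `V U`. -/
theorem intWalkCount_hadamardSteps (hU : U.Finite) (hV : V.Finite) (hT : T.Finite) (h0 : 0 ∉ T)
    (i : Fin d → ℤ) (j : Fin δ → ℤ) (n : ℕ) :
    intWalkCount (hadamardSteps U V T) (Fin.append i j) n =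
      ∑ p ∈ antidiagonal n, intColouredCount V U i p.1 n * intWalkCount T j p.2 := by
  induction n generalizing i j with
  | zero =>
    simp only [Finset.HasAntidiagonal.antidiagonal_zero, Finset.sum_singleton, intWalkCount_zero,
      intColouredCount_zero, append_eq_zero_iff]
    by_cases hi : i = 0 <;> by_cases hj : j = 0 <;> simp [hi, hj]
  | succ n ih =>
    by_cases hij : 0 ≤ i ∧ 0 ≤ j
    · obtain ⟨hi, hj⟩ := hij
      have hwhite (v : Fin d → ℤ) : ∑ p ∈ antidiagonal (n + 1),
          intColouredCount V U (i - v) p.1 n * intWalkCount T j p.2 =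
          ∑ τ ∈ hT.toFinset, intWalkCount (hadamardSteps U V T) (Fin.append (i - v) (j - τ)) n := by
        rw [sum_antidiagonal_succ_intColouredCount_mul hV hU]
        simp only [intWalkCount_succ hT hj, Finset.mul_sum, ih]
        exact Finset.sum_comm
      have hblack (u : Fin d → ℤ) : ∑ p ∈ antidiagonal (n + 1),
          intColouredCount V U (i - u) (p.1 - 1) n * intWalkCount T j p.2 =
          intWalkCount (hadamardSteps U V T) (Fin.append (i - u) j) n := by
        rw [sum_antidiagonal_succ_intColouredCount_sub_one_mul hV hU, ih]
      simp only [intColouredCount_succ hV hU hi, add_mul, Finset.sum_mul, Finset.sum_add_distrib]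
      rw [Finset.sum_comm (t := hV.toFinset), Finset.sum_comm (t := hU.toFinset),
        intWalkCount_succ (finite_hadamardSteps hU hV hT) (append_nonneg_iff.2 ⟨hi, hj⟩),
        sum_hadamardSteps hU hV hT h0, add_comm]
      simp only [append_sub_append, sub_zero, hwhite, hblack]
    · rw [intWalkCount_of_not_nonneg _ (mt append_nonneg_iff.1 hij),
        Finset.sum_eq_zero fun p _ => ?_]
      rcases not_and_or.1 hij with hi | hj
      · rw [intColouredCount_of_not_nonneg hi, zero_mul]
      · rw [intWalkCount_of_not_nonneg T hj, mul_zero]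

end HadamardCounts

section HalfLine

variable {U V : Set (Fin 1 → ℤ)}

theorem sum_smallSteps_one {R : Type*} [Semiring R] (hU : U ⊆ smallSteps 1) (hfin : U.Finite)
    (g : (Fin 1 → ℤ) → R) :
    ∑ u ∈ hfin.toFinset, g u =
      U.indicator 1 (-1) * g (-1) + U.indicator 1 0 * g 0 + U.indicator 1 1 * g 1 := by
  classical
  have hfilter : hfin.toFinset = ({-1, 0, 1} : Finset (Fin 1 → ℤ)).filter (· ∈ U) := by
    ext u
    have hsmall : u ∈ U → u = -1 ∨ u = 0 ∨ u = 1 := fun hu => by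
      simpa [smallSteps, funext_iff] using hU hu 0
    simpa using hsmall
  rw [hfilter, Finset.sum_filter, Finset.sum_insert (by decide), Finset.sum_insert (by decide),
    Finset.sum_singleton, add_assoc]
  simp [Set.indicator_apply]

/-- The generating function of coloured walks on the half-line, with the end point shifted by `a`
and the number of black steps shifted by `b`, that is `x ^ a * v ^ b * colouredGF U V`. -/
noncomputable def shiftedColouredGF (U V : Set (Fin 1 → ℤ)) (a b : ℕ) :
    MvPowerSeries (Fin 1 ⊕ Fin 2) ℚ :=
  fun m => (intColouredCount U V (fun _ => (m (Sum.inl 0) : ℤ) - a) (m (Sum.inr 0) - b)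
    (m (Sum.inr 1)) : ℚ)

theorem coeff_shiftedColouredGF (a b : ℕ) (m : Fin 1 ⊕ Fin 2 →₀ ℕ) :
    coeff m (shiftedColouredGF U V a b) =
      (intColouredCount U V (fun _ => (m (Sum.inl 0) : ℤ) - a) (m (Sum.inr 0) - b)
        (m (Sum.inr 1)) : ℚ) := rfl

theorem shiftedColouredGF_zero_zero : shiftedColouredGF U V 0 0 = colouredGF U V := by
  ext m
  rw [coeff_shiftedColouredGF, coeff_colouredGF]
  simp [Subsingleton.elim _ (0 : Fin 1)]

theorem X_inl_mul_shiftedColouredGF (a b : ℕ) :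
    X (Sum.inl 0) * shiftedColouredGF U V a b = shiftedColouredGF U V (a + 1) b := by
  refine X_mul_eq_of_coeff (fun m hm => ?_) fun m => ?_
  · rw [coeff_shiftedColouredGF, intColouredCount_of_not_nonneg, Nat.cast_zero]
    exact fun h => (Int.negSucc_lt_zero a).not_ge (by simpa [hm, Int.negSucc_eq] using h 0)
  · simp [coeff_shiftedColouredGF]

theorem X_inr_mul_shiftedColouredGF (hU : U.Finite) (hV : V.Finite) (a b : ℕ) :
    X (Sum.inr 0) * shiftedColouredGF U V a b = shiftedColouredGF U V a (b + 1) := by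
  refine X_mul_eq_of_coeff (fun m hm => ?_) fun m => ?_
  · rw [coeff_shiftedColouredGF, intColouredCount_of_notMem_Icc hU hV, Nat.cast_zero]
    rw [hm, Set.mem_Icc]
    omega
  · simp [coeff_shiftedColouredGF]

/-- The weight of the step `s` in the kernel of coloured walks: `1` if `s` can be white, plus the
variable `v` if `s` can be black. -/
noncomputable def stepWeight (U V : Set (Fin 1 → ℤ)) (s : Fin 1 → ℤ) :
    MvPowerSeries (Fin 1 ⊕ Fin 2) ℚ :=
  C (U.indicator 1 s) + C (V.indicator 1 s) * X (Sum.inr 0)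

theorem isAlgebraic_stepWeight (U V : Set (Fin 1 → ℤ)) (s : Fin 1 → ℤ) :
    IsAlgebraic (MvPolynomial (Fin 1 ⊕ Fin 2) ℚ) (stepWeight U V s) := by
  have hcoe : stepWeight U V s = ((MvPolynomial.C (U.indicator 1 s) + MvPolynomial.C
      (V.indicator 1 s) * MvPolynomial.X (Sum.inr 0) : MvPolynomial (Fin 1 ⊕ Fin 2) ℚ) :
        MvPowerSeries (Fin 1 ⊕ Fin 2) ℚ) := by
    simp [stepWeight]
  exact hcoe ▸ isAlgebraic_coe _

theorem pderiv_stepWeight (U V : Set (Fin 1 → ℤ)) (s : Fin 1 → ℤ) :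
    pderiv ℚ (Sum.inl 0) (stepWeight U V s) = 0 := by
  simp [stepWeight, Derivation.leibniz, pderiv_X_of_ne]

theorem stepWeight_mul_shiftedColouredGF (hU : U.Finite) (hV : V.Finite) (s : Fin 1 → ℤ)
    (a b : ℕ) :
    stepWeight U V s * shiftedColouredGF U V a b =
      C (U.indicator 1 s) * shiftedColouredGF U V a b +
        C (V.indicator 1 s) * shiftedColouredGF U V a (b + 1) := by
  rw [stepWeight, add_mul, mul_assoc, X_inr_mul_shiftedColouredGF hU hV]

theorem coeff_add_single_stepWeight_mul (hU : U ⊆ smallSteps 1) (hV : V ⊆ smallSteps 1)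
    (m : Fin 1 ⊕ Fin 2 →₀ ℕ) :
    coeff (m + Finsupp.single (Sum.inl 0) 1) ((stepWeight U V (-1) +
        stepWeight U V 0 * X (Sum.inl 0) + stepWeight U V 1 * X (Sum.inl 0) ^ 2) *
          colouredGF U V) =
      (intColouredCount U V (fun _ => (m (Sum.inl 0) : ℤ)) (m (Sum.inr 0)) (m (Sum.inr 1) + 1) :
        ℚ) := by
  have hUf := (finite_smallSteps 1).subset hU
  have hVf := (finite_smallSteps 1).subset hV
  have hnonneg : (0 : Fin 1 → ℤ) ≤ fun _ => (m (Sum.inl 0) : ℤ) := fun _ => Int.natCast_nonneg _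
  have hright : (m (Sum.inl 0) : ℤ) + 1 - 2 = m (Sum.inl 0) - 1 := by ring
  rw [intColouredCount_succ hUf hVf hnonneg]
  push_cast
  rw [sum_smallSteps_one hU hUf, sum_smallSteps_one hV hVf, ← shiftedColouredGF_zero_zero]
  simp only [add_mul, mul_assoc, pow_two, X_inl_mul_shiftedColouredGF,
    stepWeight_mul_shiftedColouredGF hUf hVf, map_add, coeff_C_mul, coeff_shiftedColouredGF]
  simp only [Finsupp.add_apply, Finsupp.single_eq_same, ne_eq, reduceCtorEq, not_false_eq_true,
    Finsupp.single_eq_of_ne, Nat.cast_add, Nat.cast_zero, Nat.cast_one, Nat.cast_ofNat, Pi.sub_def,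
    Pi.add_def, Pi.one_apply, add_zero, zero_add, sub_zero, sub_neg_eq_add, add_sub_cancel_right,
    one_add_one_eq_two, hright]
  ring

theorem pderiv_kernel_mul_colouredGF (hU : U ⊆ smallSteps 1) (hV : V ⊆ smallSteps 1) :
    pderiv ℚ (Sum.inl 0) ((X (Sum.inl 0) - X (Sum.inr 1) * (stepWeight U V (-1) +
      stepWeight U V 0 * X (Sum.inl 0) + stepWeight U V 1 * X (Sum.inl 0) ^ 2)) * colouredGF U V -
        X (Sum.inl 0)) = 0 := by
  classical
  rw [pderiv_eq_zero_iff]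
  intro m
  have hX : coeff (m + Finsupp.single (Sum.inl 0) 1) (X (Sum.inl 0)) =
      if m = 0 then (1 : ℚ) else 0 := by
    rw [← mul_one (X _), coeff_add_single_X_mul, coeff_one]
  rw [sub_mul, mul_assoc, map_sub, map_sub, coeff_add_single_X_mul, hX, coeff_colouredGF]
  by_cases hmt : m (Sum.inr 1) = 0
  · have hm : m = 0 ↔ (fun i => (m (Sum.inl i) : ℤ)) = 0 ∧ (m (Sum.inr 0) : ℤ) = 0 := by
      simp [Finsupp.ext_iff, Sum.forall, Fin.forall_fin_two, funext_iff, hmt]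
    rw [coeff_X_mul_of_eq_zero _ (by simp [hmt]), hmt, intColouredCount_zero]
    simp [hm]
  · obtain ⟨m, rfl⟩ := exists_add_of_le (Finsupp.single_le_iff.2 (Nat.one_le_iff_ne_zero.2 hmt))
    rw [if_neg fun h => hmt (by rw [h, Finsupp.zero_apply]), add_comm (Finsupp.single _ 1) m,
      add_right_comm, coeff_add_single_X_mul, coeff_add_single_stepWeight_mul hU hV]
    simp [Subsingleton.elim _ (0 : Fin 1)]

theorem isAlgebraic_colouredGF (hU : U ⊆ smallSteps 1) (hV : V ⊆ smallSteps 1) :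
    IsAlgebraic (MvPolynomial (Fin 1 ⊕ Fin 2) ℚ) (colouredGF U V) :=
  isAlgebraic_of_kernel_equation (t := Sum.inr 1) (by simp) (isAlgebraic_stepWeight U V _)
    (isAlgebraic_stepWeight U V _) (isAlgebraic_stepWeight U V _) (pderiv_stepWeight U V _)
    (pderiv_stepWeight U V _) (pderiv_stepWeight U V _) (pderiv_kernel_mul_colouredGF hU hV)

end HalfLine

section Gluing

open Finset.HasAntidiagonal (antidiagonal)

variable {σ σ' τ : Type*} {e : σ ↪ τ} {f : σ' ↪ τ} {s : σ} {s' : σ'}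

theorem embDomain_add_embDomain_eq_iff (hs : e s = f s')
    (hcommon : ∀ a b, e a = f b → a = s ∧ b = s') (hcover : ∀ j, j ∈ Set.range e ∪ Set.range f)
    {n : τ →₀ ℕ} {x : σ →₀ ℕ} {y : σ' →₀ ℕ} :
    x.embDomain e + y.embDomain f = n ↔ x s + y s' = n (e s) ∧
      (n.comapDomain e e.injective.injOn).update s (x s) = x ∧
      (n.comapDomain f f.injective.injOn).update s' (y s') = y := by
  classical
  have hx (a : σ) (ha : a ≠ s) : (x.embDomain e + y.embDomain f) (e a) = x a := by
    rw [Finsupp.add_apply, Finsupp.embDomain_apply_self, Finsupp.embDomain_of_notMem_range,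
      add_zero]
    exact fun ⟨b, hb⟩ => ha (hcommon a b hb.symm).1
  have hy (b : σ') (hb : b ≠ s') : (x.embDomain e + y.embDomain f) (f b) = y b := by
    rw [Finsupp.add_apply, Finsupp.embDomain_apply_self, Finsupp.embDomain_of_notMem_range,
      zero_add]
    exact fun ⟨a, ha⟩ => hb (hcommon a b ha).2
  have hxy : (x.embDomain e + y.embDomain f) (e s) = x s + y s' := by
    rw [Finsupp.add_apply, Finsupp.embDomain_apply_self, hs, Finsupp.embDomain_apply_self]
  constructor
  · rintro rfl
    refine ⟨hxy.symm, ?_, ?_⟩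
    · ext a
      by_cases ha : a = s <;> simp only [Finsupp.update_apply, ha, if_true, if_false,
        Finsupp.comapDomain_apply, hx a, ne_eq, not_false_eq_true]
    · ext b
      by_cases hb : b = s' <;> simp only [Finsupp.update_apply, hb, if_true, if_false,
        Finsupp.comapDomain_apply, hy b, ne_eq, not_false_eq_true]
  · rintro ⟨hsum, hxn, hyn⟩
    ext j
    obtain ⟨a, rfl⟩ | ⟨b, rfl⟩ := hcover j
    · obtain rfl | ha := eq_or_ne a s
      · rw [hxy, hsum]
      · rw [hx a ha, ← hxn, Finsupp.update_apply, if_neg ha, Finsupp.comapDomain_apply]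
    · obtain rfl | hb := eq_or_ne b s'
      · rw [← hs, hxy, hsum]
      · rw [hy b hb, ← hyn, Finsupp.update_apply, if_neg hb, Finsupp.comapDomain_apply]

theorem coeff_rename_mul_rename {R : Type*} [CommSemiring R] (hs : e s = f s')
    (hcommon : ∀ a b, e a = f b → a = s ∧ b = s') (hcover : ∀ j, j ∈ Set.range e ∪ Set.range f)
    (F : MvPowerSeries σ R) (G : MvPowerSeries σ' R) (n : τ →₀ ℕ) :
    coeff n (rename e F * rename f G) = ∑ p ∈ antidiagonal (n (e s)),
      coeff ((n.comapDomain e e.injective.injOn).update s p.1) F *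
        coeff ((n.comapDomain f f.injective.injOn).update s' p.2) G := by
  classical
  rw [coeff_mul]
  refine (Finset.sum_of_injOn (fun p =>
    (((n.comapDomain e e.injective.injOn).update s p.1).embDomain e,
      ((n.comapDomain f f.injective.injOn).update s' p.2).embDomain f)) ?_ ?_ ?_ ?_).symm
  · rintro ⟨k, l⟩ _ ⟨k', l'⟩ _ h
    have hk := DFunLike.congr_fun (Finsupp.embDomain_injective _ (congrArg Prod.fst h)) s
    have hl := DFunLike.congr_fun (Finsupp.embDomain_injective _ (congrArg Prod.snd h)) s'
    simpa using And.intro hk hl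
  · rintro ⟨k, l⟩ hkl
    rw [Finset.mem_coe, Finset.HasAntidiagonal.mem_antidiagonal] at hkl ⊢
    rw [embDomain_add_embDomain_eq_iff hs hcommon hcover]
    simpa using hkl
  · rintro ⟨p, q⟩ hpq hnot
    rw [Finset.HasAntidiagonal.mem_antidiagonal] at hpq
    by_contra hne
    have hp := left_ne_zero_of_mul hne
    have hq := right_ne_zero_of_mul hne
    obtain ⟨x, rfl⟩ := exists_embDomain_eq e (m := p) fun j hj =>
      not_not.1 fun h => hp (coeff_rename_eq_zero_of_ne_zero e hj h)
    obtain ⟨y, rfl⟩ := exists_embDomain_eq f (m := q) fun j hj =>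
      not_not.1 fun h => hq (coeff_rename_eq_zero_of_ne_zero f hj h)
    obtain ⟨hxy, hx, hy⟩ := (embDomain_add_embDomain_eq_iff hs hcommon hcover).1 hpq
    refine hnot ⟨(x s, y s'), ?_, ?_⟩
    · exact Finset.mem_coe.2 (Finset.HasAntidiagonal.mem_antidiagonal.2 hxy)
    · simp only [hx, hy]
  · intro p _
    rw [coeff_embDomain_rename, coeff_embDomain_rename]

end Gluing

section Hadamard

variable {d δ : ℕ}

/-- The variables of coloured walks among those of Hadamard walks and a new one, `none`: the number
of black steps becomes the exponent of the new variable. -/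
def colouredVars (d δ : ℕ) : Fin d ⊕ Fin 2 ↪ Option (Fin (d + δ) ⊕ Unit) where
  toFun := Sum.elim (fun i => some (Sum.inl (Fin.castAdd δ i))) ![none, some (Sum.inr ())]
  inj' := by
    rintro (i | i) (j | j)
    · simp
    · fin_cases j <;> simp
    · fin_cases i <;> simp
    · revert i j
      simp [Fin.forall_fin_two]

/-- The variables of walks in the last `δ` dimensions among those of Hadamard walks and a new one,
`none`: the length of the walk becomes the exponent of the new variable. -/
def orthantVars (d δ : ℕ) : Fin δ ⊕ Unit ↪ Option (Fin (d + δ) ⊕ Unit) where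
  toFun := Sum.elim (fun j => some (Sum.inl (Fin.natAdd d j))) fun _ => none
  inj' := by rintro (i | i) (j | j) <;> simp

theorem colouredVars_inl (i : Fin d) :
    colouredVars d δ (Sum.inl i) = some (Sum.inl (Fin.castAdd δ i)) := rfl

theorem colouredVars_inr_zero : colouredVars d δ (Sum.inr 0) = none := rfl

theorem colouredVars_inr_one : colouredVars d δ (Sum.inr 1) = some (Sum.inr ()) := rfl

theorem orthantVars_inl (j : Fin δ) :
    orthantVars d δ (Sum.inl j) = some (Sum.inl (Fin.natAdd d j)) := rfl

theorem orthantVars_inr (u : Unit) : orthantVars d δ (Sum.inr u) = none := rfl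

theorem eq_of_colouredVars_eq_orthantVars (a : Fin d ⊕ Fin 2) (b : Fin δ ⊕ Unit)
    (h : colouredVars d δ a = orthantVars d δ b) : a = Sum.inr 0 ∧ b = Sum.inr () := by
  have hdisjoint (i : Fin d) (j : Fin δ) : Fin.castAdd δ i ≠ Fin.natAdd d j :=
    Fin.ne_of_val_ne (by simp only [Fin.val_castAdd, Fin.val_natAdd]; omega)
  obtain i | k := a
  · obtain j | _ := b <;> simp [colouredVars_inl, orthantVars_inl, orthantVars_inr, hdisjoint] at h
  · revert h
    fin_cases k <;> obtain j | _ := b <;>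
      simp [colouredVars_inr_zero, colouredVars_inr_one, orthantVars_inl, orthantVars_inr]

theorem mem_range_colouredVars_union_range_orthantVars (j : Option (Fin (d + δ) ⊕ Unit)) :
    j ∈ Set.range (colouredVars d δ) ∪ Set.range (orthantVars d δ) := by
  obtain _ | i | _ := j
  · exact Or.inr ⟨Sum.inr (), rfl⟩
  · induction i using Fin.addCases with
    | left i => exact Or.inl ⟨Sum.inl i, rfl⟩
    | right j => exact Or.inr ⟨Sum.inl j, rfl⟩
  · exact Or.inl ⟨Sum.inr 1, rfl⟩

theorem walkGF_hadamardSteps {U V : Set (Fin d → ℤ)} {T : Set (Fin δ → ℤ)} (hU : U.Finite)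
    (hV : V.Finite) (hT : T.Finite) (h0 : 0 ∉ T) :
    walkGF (hadamardSteps U V T) = diagonal (Sum.inr ())
      (rename (colouredVars d δ) (colouredGF V U) * rename (orthantVars d δ) (walkGF T)) := by
  ext m
  have happend : (fun i => (m (Sum.inl i) : ℤ)) =
      Fin.append (fun i => (m (Sum.inl (Fin.castAdd δ i)) : ℤ))
        fun j => (m (Sum.inl (Fin.natAdd d j)) : ℤ) := by
    ext i
    induction i using Fin.addCases <;> simp
  rw [coeff_walkGF, happend, intWalkCount_hadamardSteps hU hV hT h0, coeff_superdiagonal,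
    coeff_rename_mul_rename (e := colouredVars d δ) (f := orthantVars d δ) (s := Sum.inr 0)
      (s' := Sum.inr ()) rfl eq_of_colouredVars_eq_orthantVars
      mem_range_colouredVars_union_range_orthantVars,
    colouredVars_inr_zero, superdiagExp_none, Nat.cast_sum]
  refine Finset.sum_congr rfl fun p _ => ?_
  simp [coeff_colouredGF, coeff_walkGF, Finsupp.update_apply, colouredVars_inl,
    colouredVars_inr_one, orthantVars_inl, superdiagExp_some]

theorem mainTheorem7_general {U V : Set (Fin 1 → ℤ)} (hU : U ⊆ smallSteps 1)
    (hV : V ⊆ smallSteps 1) {δ : ℕ} {T : Set (Fin δ → ℤ)} (hT : T.Finite) (h0 : 0 ∉ T) :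
    IsAlgebraic (MvPolynomial (Fin 1 ⊕ Fin 2) ℚ) (colouredGF U V) ∧
      (DFinite (walkGF T) → DFinite (walkGF (hadamardSteps U V T))) := by
  refine ⟨isAlgebraic_colouredGF hU hV, fun hC₂ => ?_⟩
  have hC₁ : Holonomic (colouredGF V U) := .of_isAlgebraic (isAlgebraic_colouredGF hV hU)
  rw [walkGF_hadamardSteps ((finite_smallSteps 1).subset hU) ((finite_smallSteps 1).subset hV) hT
    h0]
  exact ((hC₁.rename _).mul (hC₂.holonomic.rename _)).dFinite_diagonal _

end Hadamard

end OctantWalks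

theorem mainTheorem7 (S : Set (Fin 3 → ℤ))
    (U V : Set (Fin 1 → ℤ)) (T : Set (Fin 2 → ℤ))
    (hU : U ⊆ OctantWalks.smallSteps 1 \ {0})
    (hV : V ⊆ OctantWalks.smallSteps 1)
    (hT : T ⊆ OctantWalks.smallSteps 2 \ {0})
    (hS : S = OctantWalks.hadamardSteps U V T) :
    IsAlgebraic (MvPolynomial (Fin 1 ⊕ Fin 2) ℚ) (OctantWalks.colouredGF U V) ∧
      (OctantWalks.DFinite (OctantWalks.walkGF T) →
        OctantWalks.DFinite (OctantWalks.walkGF S)) := by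
  subst hS
  exact OctantWalks.mainTheorem7_general (hU.trans Set.sdiff_subset) hV
    ((OctantWalks.finite_smallSteps 2).subset (hT.trans Set.sdiff_subset)) fun h => (hT h).2 rfl
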